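/- Write the $4^n$ $n$-qubit Pauli operators as $P_a=\bigotimes_{j=1}^n i^{a_{x,j}a_{z,j}}X^{a_{x,j}}Z^{a_{z,j}}$, $a\in\mathbb Z_2^{2n}$, and let $\langle a,b\rangle=\sum_j(a_{x,j}b_{z,j}+a_{z,j}b_{x,j})\bmod 2$. An $n$-qubit Pauli channel is $\Lambda(\rho)=\sum_a p_aP_a\rho P_a$ with $(p_a)_a$ a probability distribution; its Pauli eigenvalues are $\lambda_b=\sum_a p_a(-1)^{\langle a,b\rangle}$, so that $\Lambda(P_b)=\lambda_bP_b$. Consider the following measurement protocols for an unknown $n$-qubit Pauli channel $\Lambda$. All POVMs have finitely many outcomes, and the estimate $(\widehat\lambda_a)_{a\in\mathbb Z_2^{2n}}$ is a function of the recorded outcomes. * *Adaptive, non-concatenating, with a $k$-qubit ancilla:* for each of the $N$ samples one prepares an $(n+k)$-qubit state, applies $\Lambda\otimes\mathrm{id}$ once and measures a POVM on all $n+k$ qubits; state and POVM may depend on the earlier outcomes. The protocol is *non-adaptive* if they do not. * *Adaptive, concatenating, ancilla-free:* in each of $N'$ rounds one prepares an $n$-qubit state $\rho$, produces $\Lambda(\mathcal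 C_{M-1}(\cdots\Lambda(\mathcal C_1(\Lambda(\rho)))\cdots))$ with $M\ge 1$ uses of $\Lambda$ and $n$-qubit quantum channels $\mathcal C_i$, and measures a POVM; $\rho$, $M$, the $\mathcal C_i$ and the POVM may depend on the earlier outcomes. The number of samples $N$ is the total number of uses of $\Lambda$. * *Fully entangled:* one prepares a joint state of the $n$ qubits and a memory of arbitrary finite dimension, applies $\Lambda\otimes\mathrm{id}$ $N$ times, interleaved with arbitrary joint quantum channels, and measures a joint POVM. Fix a success probability $p>1/2$. There is a constant $c>0$ depending only on $p$ such that, for all $n\ge 1$ and $0\le k\le n$, every protocol of the stated type which, for every $n$-qubit Pauli channel $\Lambda$, satisfies $$|\widehat\lambda_a-\lambda_a|\le \tfrac12\quad\text{for all }a\in\mathbb Z_2^{2n}$$ with probability at least $p$, obeys: (A) $N\ge c\,n\,2^{n-k}$ if it is non-adaptive, non-concatenating with a $k$-qubit ancilla; (B) $N\ge c\,2^{(n-k)/3}$ if it is adaptive, non-concatenating with a $k$-qubit ancilla; (C) $N\ge N'\ge c\,2^{n/3}$ if it is adaptive, concatenating and ancilla-free, where $N'$ is the number of measurement rounds and $N$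 is the number of samples used along any record of outcomes; (D) $N\ge c\,n$ if it is fully entangled. -/

import Mathlib

open scoped Kronecker ComplexOrder

noncomputable section

/-! ### Pauli operators and Pauli channels -/

/-- The index set of the computational basis of `n` qubits. -/
abbrev Qubits (n : ℕ) : Type := Fin n → Fin 2

/-- Labels `a = a_{x,1} a_{z,1} ⋯ a_{x,n} a_{z,n} ∈ ℤ₂^{2n}` of the `n`-qubit Pauli operators;
the `j`-th entry is the pair `(a_{x,j}, a_{z,j})`. -/
abbrev PauliLabel (n : ℕ) : Type := Fin n → ZMod 2 × ZMod 2

/-- The Pauli matrix `X`. -/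
def pauliX : Matrix (Fin 2) (Fin 2) ℂ := !![0, 1; 1, 0]

/-- The Pauli matrix `Z`. -/
def pauliZ : Matrix (Fin 2) (Fin 2) ℂ := !![1, 0; 0, -1]

/-- The single-qubit Pauli operator `i^{xz} X^x Z^z`. -/
def pauli₁ (q : ZMod 2 × ZMod 2) : Matrix (Fin 2) (Fin 2) ℂ :=
  Complex.I ^ (q.1.val * q.2.val) • (pauliX ^ q.1.val * pauliZ ^ q.2.val)

/-- The `n`-qubit Pauli operator `P_a`, the tensor product of its single-qubit factors. -/
def pauli {n : ℕ} (a : PauliLabel n) : Matrix (Qubits n) (Qubits n) ℂ :=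
  Matrix.of fun i j => ∏ l, pauli₁ (a l) (i l) (j l)

/-- The symplectic inner product `⟨a, b⟩ ∈ ℤ₂`. -/
def symplectic {n : ℕ} (a b : PauliLabel n) : ZMod 2 :=
  ∑ l, ((a l).1 * (b l).2 + (a l).2 * (b l).1)

/-- An `n`-qubit Pauli channel, given by its Pauli error rates. -/
structure PauliChannel (n : ℕ) where
  rate : PauliLabel n → ℝ
  rate_nonneg : ∀ a, 0 ≤ rate a
  rate_sum : ∑ a, rate a = 1

/-- The Pauli eigenvalue `λ_b = ∑_a p_a (-1)^⟨a,b⟩`, i.e. `Λ(P_b) = λ_b P_b`. -/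
def PauliChannel.eigenvalue {n : ℕ} (L : PauliChannel n) (b : PauliLabel n) : ℝ :=
  ∑ a, L.rate a * (-1) ^ (symplectic a b).val

/-- The action `Λ(ρ) = ∑_a p_a P_a ρ P_a` on the operators of the `n`-qubit system. -/
def PauliChannel.apply {n : ℕ} (L : PauliChannel n) (ρ : Matrix (Qubits n) (Qubits n) ℂ) :
    Matrix (Qubits n) (Qubits n) ℂ :=
  ∑ a, (L.rate a : ℂ) • (pauli a * ρ * pauli a)

/-- The action of `Λ ⊗ id` on the joint operators of the `n`-qubit system and an ancilla whose
basis is indexed by `κ`. -/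
def PauliChannel.applyAux {n : ℕ} (L : PauliChannel n) {κ : Type*} [Fintype κ] [DecidableEq κ]
    (ρ : Matrix (Qubits n × κ) (Qubits n × κ) ℂ) :
    Matrix (Qubits n × κ) (Qubits n × κ) ℂ :=
  ∑ a, (L.rate a : ℂ) •
    ((pauli a ⊗ₖ (1 : Matrix κ κ ℂ)) * ρ * (pauli a ⊗ₖ (1 : Matrix κ κ ℂ)))

/-! ### States, measurements and processing channels -/

/-- A density matrix. -/
structure QState (d : Type*) [Fintype d] where
  mat : Matrix d d ℂ
  posSemidef : mat.PosSemidef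
  trace_eq_one : mat.trace = 1

/-- A POVM with outcomes in the finite set `O`. -/
structure POVM (d : Type*) [Fintype d] [DecidableEq d] (O : Type*) [Fintype O] where
  effect : O → Matrix d d ℂ
  posSemidef : ∀ o, (effect o).PosSemidef
  sum_eq_one : ∑ o, effect o = 1

/-- Born rule: the probability `Tr (E_o ρ)` of the outcome `o`. -/
def POVM.prob {d : Type*} [Fintype d] [DecidableEq d] {O : Type*} [Fintype O]
    (E : POVM d O) (ρ : Matrix d d ℂ) (o : O) : ℝ :=
  ((E.effect o * ρ).trace).re

/-- The ampliation `Φ ⊗ id_m` of a linear map `Φ` on matrices. -/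
def ampliate {d : Type*} (Φ : Matrix d d ℂ →ₗ[ℂ] Matrix d d ℂ) (m : ℕ)
    (X : Matrix (d × Fin m) (d × Fin m) ℂ) : Matrix (d × Fin m) (d × Fin m) ℂ :=
  Matrix.of fun u v => Φ (Matrix.of fun i j => X (i, u.2) (j, v.2)) u.1 v.1

/-- A quantum channel: a completely positive trace-preserving linear map. -/
structure QChannel (d : Type*) [Fintype d] where
  map : Matrix d d ℂ →ₗ[ℂ] Matrix d d ℂ
  completelyPositive : ∀ (m : ℕ) (X : Matrix (d × Fin m) (d × Fin m) ℂ),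
    X.PosSemidef → (ampliate map m X).PosSemidef
  tracePreserving : ∀ X, (map X).trace = X.trace

/-! ### Measurement protocols -/

/-- An estimate is *good* for `Λ` if it is within `1/2` of every Pauli eigenvalue. -/
def GoodEstimate {n : ℕ} (L : PauliChannel n) (est : PauliLabel n → ℝ) : Prop :=
  ∀ a, |est a - L.eigenvalue a| ≤ 1 / 2

open Classical in
/-- With `prob L r` the probability of the measurement record `r` when the unknown channel is `L`:
for every Pauli channel, the estimate computed from the record is good with probability at least
`p`. -/
def EstimatesWithProb {n : ℕ} {R : Type*} [Fintype R] (prob : PauliChannel n → R → ℝ)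
    (est : R → PauliLabel n → ℝ) (p : ℝ) : Prop :=
  ∀ L : PauliChannel n, p ≤ ∑ r with GoodEstimate L (est r), prob L r

/-- The outcomes `o_{<i}` obtained before round `i`. -/
def history {N : ℕ} {O : Type*} (o : Fin N → O) (i : Fin N) : Fin i → O :=
  fun j => o (Fin.castLE i.isLt.le j)

/-- A non-adaptive, non-concatenating protocol with a `k`-qubit ancilla using `N` samples: for
each sample a fixed input state and a fixed POVM on the `n + k` qubits, and classical processing
of all the outcomes. -/
structure NonadaptiveProtocol (n k N : ℕ) (O : Type) [Fintype O] where
  input : Fin N → QState (Qubits n × Qubits k)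
  meas : Fin N → POVM (Qubits n × Qubits k) O
  estimate : (Fin N → O) → PauliLabel n → ℝ

/-- Probability of a record of outcomes. -/
def NonadaptiveProtocol.prob {n k N : ℕ} {O : Type} [Fintype O]
    (A : NonadaptiveProtocol n k N O) (L : PauliChannel n) (o : Fin N → O) : ℝ :=
  ∏ i, (A.meas i).prob (L.applyAux (A.input i).mat) (o i)

/-- An adaptive, non-concatenating protocol with a `k`-qubit ancilla using `N` samples: the input
state and the POVM for each sample may depend on the previous outcomes. -/
structure AdaptiveProtocol (n k N : ℕ) (O : Type) [Fintype O] where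
  input : (i : Fin N) → (Fin i → O) → QState (Qubits n × Qubits k)
  meas : (i : Fin N) → (Fin i → O) → POVM (Qubits n × Qubits k) O
  estimate : (Fin N → O) → PauliLabel n → ℝ

/-- Probability of a record of outcomes. -/
def AdaptiveProtocol.prob {n k N : ℕ} {O : Type} [Fintype O]
    (A : AdaptiveProtocol n k N O) (L : PauliChannel n) (o : Fin N → O) : ℝ :=
  ∏ i, (A.meas i (history o i)).prob (L.applyAux (A.input i (history o i)).mat) (o i)

/-- The state `Λ(C_{M-1}(⋯ Λ(C_1(Λ(ρ))) ⋯))` obtained from `ρ` by `M` uses of `Λ`, where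
`[C_1, …, C_{M-1}]` is the list of processing channels applied in between. -/
def PauliChannel.concat {n : ℕ} (L : PauliChannel n) (procs : List (QChannel (Qubits n)))
    (ρ : Matrix (Qubits n) (Qubits n) ℂ) : Matrix (Qubits n) (Qubits n) ℂ :=
  procs.foldl (fun σ C => L.apply (C.map σ)) (L.apply ρ)

/-- An adaptive, concatenating, ancilla-free protocol with `N` rounds of measurement. In each
round an `n`-qubit state is prepared, the unknown channel is applied a number `M ≥ 1` of times,
interleaved with the `M - 1` processing channels in the list `proc`, and the result is measured;
state, processing channels (and hence `M`) and POVM may depend on the previous outcomes. -/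
structure ConcatProtocol (n N : ℕ) (O : Type) [Fintype O] where
  input : (i : Fin N) → (Fin i → O) → QState (Qubits n)
  proc : (i : Fin N) → (Fin i → O) → List (QChannel (Qubits n))
  meas : (i : Fin N) → (Fin i → O) → POVM (Qubits n) O
  estimate : (Fin N → O) → PauliLabel n → ℝ

/-- Probability of a record of outcomes. -/
def ConcatProtocol.prob {n N : ℕ} {O : Type} [Fintype O]
    (A : ConcatProtocol n N O) (L : PauliChannel n) (o : Fin N → O) : ℝ :=
  ∏ i, (A.meas i (history o i)).prob
    (L.concat (A.proc i (history o i)) (A.input i (history o i)).mat) (o i)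

/-- The total number of uses of the unknown channel along a record of outcomes. -/
def ConcatProtocol.samples {n N : ℕ} {O : Type} [Fintype O]
    (A : ConcatProtocol n N O) (o : Fin N → O) : ℕ :=
  ∑ i, ((A.proc i (history o i)).length + 1)

/-- A fully entangled protocol using `N` samples, with a quantum memory of arbitrary finite
dimension (basis indexed by `κ`): a joint state is prepared, the unknown channel is applied `N`
times to the `n`-qubit system, each use being followed by an arbitrary joint processing channel on
system and memory, and finally one joint POVM is measured. -/
structure EntangledProtocol (n N : ℕ) (κ : Type) [Fintype κ] [DecidableEq κ]
    (O : Type) [Fintype O] where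
  input : QState (Qubits n × κ)
  proc : Fin N → QChannel (Qubits n × κ)
  meas : POVM (Qubits n × κ) O
  estimate : O → PauliLabel n → ℝ

/-- Probability of the outcome of the final measurement. -/
def EntangledProtocol.prob {n N : ℕ} {κ : Type} [Fintype κ] [DecidableEq κ] {O : Type} [Fintype O]
    (A : EntangledProtocol n N κ O) (L : PauliChannel n) (o : O) : ℝ :=
  A.meas.prob
    ((List.ofFn A.proc).foldl (fun σ C => C.map (L.applyAux σ)) A.input.mat) o

end

/-! All four bounds come from one needle-in-a-haystack family. With ε = `pauliGap n`, `markedChannel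
b` (b ≠ 0) has eigenvalue 1 at 0 and at b, and −ε elsewhere; `backgroundChannel` has eigenvalue 1 at
0 only. No estimate is good for two different marked channels, so the success events S_b are 4^n − 1
disjoint events, and under any reference distribution Q their probabilities sum to at most 1. Since
the protocol gives each S_b probability at least p under the b-th channel, the records must depend
on b; each bound limits how fast that dependence can build up.

Without concatenation, Q is the background experiment. The change in an outcome probability caused
by marking b is a Fourier coefficient in b of the bounded function a ↦ Tr(E_o P_a ρ P_a). Parseval
then bounds the χ²-divergences of one measurement, summed over b, by 8·2^(n+k)
(`POVM.sum_chiSq_le`). For product experiments χ² enters through an exponential, and a Fano-type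
logarithm yields the factor n in (A). For adaptive experiments Cauchy–Schwarz turns χ² into total
variation, which adds up linearly over the rounds by a hybrid argument, still summed over b; this
gives (B).

With concatenation, a marked channel sends every state to the maximally mixed state plus a multiple
of P_b, up to O(ε). Only the last use of the channel in a round matters, whatever state precedes it.
Relative to the maximally mixed outcomes, Parseval for Pauli operators bounds the one-round
distances summed over b, and the same hybrid argument gives (C).

For (D), the marked error rates are at most 4 times the background rates. Hence N uses, interleaved
with arbitrary channels, raise the probability of S_b by a factor of at most 4^N over the
background; summing over the disjoint events gives (4^n − 1)p ≤ 4^N. -/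

noncomputable section

/-! ### The Pauli sign characters -/

/-- The sign `(-1)^⟨a,b⟩`. -/
def pauliSign {n : ℕ} (a b : PauliLabel n) : ℝ := (-1) ^ (symplectic a b).val

/-- The sign `(-1)^⟨q,r⟩` for a single qubit. -/
def pauliSign₁ (q r : ZMod 2 × ZMod 2) : ℝ := (-1) ^ (q.1 * r.2 + q.2 * r.1 : ZMod 2).val

lemma neg_one_pow_val_add (x y : ZMod 2) :
    (-1 : ℝ) ^ (x + y).val = (-1) ^ x.val * (-1) ^ y.val := by
  rw [ZMod.val_add, ← pow_add, ← neg_one_pow_eq_pow_mod_two]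

/-- Signs and Pauli matrix entries both factor over the qubits, so identities summed over all labels
reduce to finite one-qubit checks through `Fintype.prod_sum`. -/
lemma pauliSign_eq_prod {n : ℕ} (a b : PauliLabel n) :
    pauliSign a b = ∏ l, pauliSign₁ (a l) (b l) := by
  have h : ∀ s : Finset (Fin n),
      (-1 : ℝ) ^ (∑ l ∈ s, ((a l).1 * (b l).2 + (a l).2 * (b l).1)).val =
        ∏ l ∈ s, pauliSign₁ (a l) (b l) := by
    intro s
    induction s using Finset.induction_on with
    | empty => simp
    | insert i s hi ih =>
      rw [Finset.sum_insert hi, Finset.prod_insert hi, neg_one_pow_val_add, ih]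
      rfl
  exact h Finset.univ

lemma pauliSign_comm {n : ℕ} (a b : PauliLabel n) : pauliSign a b = pauliSign b a := by
  simp only [pauliSign, symplectic]
  congr 2
  exact Finset.sum_congr rfl fun l _ => by ring

lemma pauliSign_mul_self {n : ℕ} (a b : PauliLabel n) : pauliSign a b * pauliSign a b = 1 := by
  rw [pauliSign, ← mul_pow]; simp

lemma neg_one_le_pauliSign {n : ℕ} (a b : PauliLabel n) : -1 ≤ pauliSign a b := by
  nlinarith [pauliSign_mul_self a b, sq_nonneg (pauliSign a b + 1)]

lemma pauliSign_le_one {n : ℕ} (a b : PauliLabel n) : pauliSign a b ≤ 1 := by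
  nlinarith [pauliSign_mul_self a b, sq_nonneg (pauliSign a b + 1)]

@[simp] lemma pauliSign_zero_left {n : ℕ} (a : PauliLabel n) : pauliSign 0 a = 1 := by
  simp [pauliSign, symplectic]

@[simp] lemma pauliSign_zero_right {n : ℕ} (a : PauliLabel n) : pauliSign a 0 = 1 := by
  simp [pauliSign, symplectic]

lemma sum_zmod_two_prod {M : Type*} [AddCommMonoid M] (f : ZMod 2 × ZMod 2 → M) :
    ∑ q, f q = f (0, 0) + f (0, 1) + (f (1, 0) + f (1, 1)) := by
  have h : ∀ g : ZMod 2 → M, ∑ x, g x = g 0 + g 1 := fun g => Fin.sum_univ_two g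
  rw [Fintype.sum_prod_type, h, h, h]

lemma zmod_two_prod_cases (q : ZMod 2 × ZMod 2) :
    q = (0, 0) ∨ q = (0, 1) ∨ q = (1, 0) ∨ q = (1, 1) := by
  revert q; decide

lemma sum_pauliSign₁_mul (r s : ZMod 2 × ZMod 2) :
    ∑ q, pauliSign₁ q r * pauliSign₁ q s = if r = s then 4 else 0 := by
  have v1 : (1 : ZMod 2).val = 1 := rfl
  have v2 : (2 : ZMod 2).val = 0 := rfl
  rw [sum_zmod_two_prod]
  rcases zmod_two_prod_cases r with rfl | rfl | rfl | rfl <;>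
  rcases zmod_two_prod_cases s with rfl | rfl | rfl | rfl <;>
  norm_num [pauliSign₁, v1, v2]

lemma card_pauliLabel (n : ℕ) : Fintype.card (PauliLabel n) = 4 ^ n := by
  simp [PauliLabel]

lemma sum_pauliSign_mul {n : ℕ} (b c : PauliLabel n) :
    ∑ a, pauliSign a b * pauliSign a c = if b = c then (4 : ℝ) ^ n else 0 := by
  simp_rw [pauliSign_eq_prod, ← Finset.prod_mul_distrib]
  rw [← Fintype.prod_sum fun (l : Fin n) q => pauliSign₁ q (b l) * pauliSign₁ q (c l)]
  simp_rw [sum_pauliSign₁_mul]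
  split_ifs with h
  · simp [h]
  · obtain ⟨l, hl⟩ := Function.ne_iff.mp h
    exact Finset.prod_eq_zero (Finset.mem_univ l) (if_neg hl)

lemma sum_pauliSign {n : ℕ} (b : PauliLabel n) :
    ∑ a, pauliSign a b = if b = 0 then (4 : ℝ) ^ n else 0 := by
  simpa using sum_pauliSign_mul b 0

/-- Parseval's identity for the sign characters. -/
lemma sum_sq_sum_pauliSign_mul {n : ℕ} (g : PauliLabel n → ℝ) :
    ∑ b, (∑ a, pauliSign a b * g a) ^ 2 = 4 ^ n * ∑ a, g a ^ 2 := by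
  have h : ∀ b, (∑ a, pauliSign a b * g a) ^ 2 =
      ∑ a, ∑ a', pauliSign b a * pauliSign b a' * (g a * g a') := by
    intro b
    rw [sq, Finset.sum_mul_sum]
    refine Finset.sum_congr rfl fun a _ => Finset.sum_congr rfl fun a' _ => ?_
    rw [pauliSign_comm a b, pauliSign_comm a' b]; ring
  simp_rw [h]
  rw [Finset.sum_comm, Finset.mul_sum]
  refine Finset.sum_congr rfl fun a _ => ?_
  rw [Finset.sum_comm]
  simp_rw [← Finset.sum_mul, sum_pauliSign_mul]
  simp [sq]

/-! ### Pauli operators -/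

lemma pauli₁_zero_zero : pauli₁ (0, 0) = !![1, 0; 0, 1] := by
  simp [pauli₁, Matrix.one_fin_two]

lemma pauli₁_zero_one : pauli₁ (0, 1) = !![1, 0; 0, -1] := by
  have v1 : (1 : ZMod 2).val = 1 := rfl
  simp [pauli₁, pauliZ, v1]

lemma pauli₁_one_zero : pauli₁ (1, 0) = !![0, 1; 1, 0] := by
  have v1 : (1 : ZMod 2).val = 1 := rfl
  simp [pauli₁, pauliX, v1]

lemma pauli₁_one_one : pauli₁ (1, 1) = !![0, -Complex.I; Complex.I, 0] := by
  have v1 : (1 : ZMod 2).val = 1 := rfl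
  simp [pauli₁, pauliX, pauliZ, v1]

lemma star_pauli₁ (q : ZMod 2 × ZMod 2) (i j : Fin 2) : star (pauli₁ q i j) = pauli₁ q j i := by
  rcases zmod_two_prod_cases q with rfl | rfl | rfl | rfl <;> fin_cases i <;> fin_cases j <;>
  simp [pauli₁_zero_zero, pauli₁_zero_one, pauli₁_one_zero, pauli₁_one_one]

lemma pauli₁_mul_self (q : ZMod 2 × ZMod 2) (i j : Fin 2) :
    ∑ k, pauli₁ q i k * pauli₁ q k j = if i = j then 1 else 0 := by
  rcases zmod_two_prod_cases q with rfl | rfl | rfl | rfl <;> fin_cases i <;> fin_cases j <;>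
  simp [pauli₁_zero_zero, pauli₁_zero_one, pauli₁_one_zero, pauli₁_one_one]

lemma sum_pauliSign₁_mul_pauli₁ (r : ZMod 2 × ZMod 2) (i j k l : Fin 2) :
    ∑ q, (pauliSign₁ q r : ℂ) * (pauli₁ q i j * pauli₁ q k l) =
      2 * (pauli₁ r k j * pauli₁ r i l) := by
  have v1 : (1 : ZMod 2).val = 1 := rfl
  have v2 : (2 : ZMod 2).val = 0 := rfl
  rw [sum_zmod_two_prod]
  rcases zmod_two_prod_cases r with rfl | rfl | rfl | rfl <;>
  fin_cases i <;> fin_cases j <;> fin_cases k <;> fin_cases l <;>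
  norm_num [pauliSign₁, v1, v2, pauli₁_zero_zero, pauli₁_zero_one, pauli₁_one_zero, pauli₁_one_one]

lemma pauli_isHermitian {n : ℕ} (a : PauliLabel n) : (pauli a).IsHermitian := by
  ext i j
  simp only [Matrix.conjTranspose_apply, pauli, Matrix.of_apply, star_prod, star_pauli₁]

lemma pauli_mul_self {n : ℕ} (a : PauliLabel n) : pauli a * pauli a = 1 := by
  ext i j
  simp only [Matrix.mul_apply, pauli, Matrix.of_apply, ← Finset.prod_mul_distrib]
  rw [← Fintype.prod_sum fun (l : Fin n) q => pauli₁ (a l) (i l) q * pauli₁ (a l) q (j l)]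
  simp_rw [pauli₁_mul_self, Matrix.one_apply]
  split_ifs with h
  · simp [h]
  · obtain ⟨l, hl⟩ := Function.ne_iff.mp h
    exact Finset.prod_eq_zero (Finset.mem_univ l) (if_neg hl)

@[simp] lemma pauli_zero {n : ℕ} : pauli (0 : PauliLabel n) = 1 := by
  ext i j
  have h : ∀ x y : Fin 2, pauli₁ 0 x y = if x = y then 1 else 0 := by
    intro x y
    rw [show (0 : ZMod 2 × ZMod 2) = (0, 0) from rfl, pauli₁_zero_zero]
    fin_cases x <;> fin_cases y <;> rfl
  simp only [pauli, Matrix.of_apply, Matrix.one_apply, Pi.zero_apply, h]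
  split_ifs with h
  · simp [h]
  · obtain ⟨l, hl⟩ := Function.ne_iff.mp h
    exact Finset.prod_eq_zero (Finset.mem_univ l) (if_neg hl)

/-- Fierz-type identity. For b = 0 it expands the swap operator in Paulis, which is Parseval for
matrices; contracted with a matrix for general b, it is the signed twirl. -/
lemma sum_pauliSign_mul_pauli {n : ℕ} (b : PauliLabel n) (i j k l : Qubits n) :
    ∑ a, (pauliSign a b : ℂ) * (pauli a i j * pauli a k l) =
      2 ^ n * (pauli b k j * pauli b i l) := by
  simp only [pauliSign_eq_prod, Complex.ofReal_prod, pauli, Matrix.of_apply,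
    ← Finset.prod_mul_distrib]
  rw [← Fintype.prod_sum fun (m : Fin n) q => ((pauliSign₁ q (b m) : ℂ) *
    (pauli₁ q (i m) (j m) * pauli₁ q (k m) (l m)))]
  simp_rw [sum_pauliSign₁_mul_pauli₁]
  simp [Finset.prod_mul_distrib]

/-- The Pauli twirl. -/
lemma sum_pauliSign_smul_conj {n : ℕ} (b : PauliLabel n) (σ : Matrix (Qubits n) (Qubits n) ℂ) :
    ∑ a, (pauliSign a b : ℂ) • (pauli a * σ * pauli a) =
      (2 ^ n * (pauli b * σ).trace) • pauli b := by
  ext i l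
  simp only [Matrix.sum_apply, Matrix.smul_apply, Matrix.mul_apply, Matrix.trace, Matrix.diag,
    smul_eq_mul, Finset.sum_mul, Finset.mul_sum]
  rw [Finset.sum_comm]
  refine Finset.sum_congr rfl fun k _ => ?_
  rw [Finset.sum_comm]
  refine Finset.sum_congr rfl fun j _ => ?_
  have := sum_pauliSign_mul_pauli b i j k l
  calc _ = (∑ a, (pauliSign a b : ℂ) * (pauli a i j * pauli a k l)) * σ j k := by
        rw [Finset.sum_mul]; exact Finset.sum_congr rfl fun a _ => by ring
    _ = _ := by rw [this]; ring

/-- The Pauli operators form an orthogonal basis: Parseval's identity for matrices. -/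
lemma sum_trace_mul_pauli_sq {n : ℕ} (E : Matrix (Qubits n) (Qubits n) ℂ) :
    ∑ a, (E * pauli a).trace ^ 2 = 2 ^ n * (E * E).trace := by
  -- The inserted factor `pauliSign a 0` equals 1; it puts the sum into the form of
  -- `sum_pauliSign_mul_pauli` with b = 0.
  have h2 : ∀ a : PauliLabel n, (E * pauli a).trace ^ 2 =
      ∑ i, ∑ j, ∑ k, ∑ l, E j i * E l k * ((pauliSign a 0 : ℂ) * (pauli a i j * pauli a k l)) := by
    intro a
    rw [Matrix.trace_mul_comm E]
    simp only [sq, Matrix.trace, Matrix.diag, Matrix.mul_apply]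
    rw [Finset.sum_mul_sum]
    refine Finset.sum_congr rfl fun i _ => ?_
    simp only [Finset.sum_mul_sum]
    rw [Finset.sum_comm]
    refine Finset.sum_congr rfl fun j _ => Finset.sum_congr rfl fun k _ =>
      Finset.sum_congr rfl fun l _ => ?_
    simp; ring
  simp_rw [h2]
  rw [Finset.sum_comm]
  simp only [Matrix.trace, Matrix.diag, Matrix.mul_apply, Finset.mul_sum]
  refine Finset.sum_congr rfl fun i _ => ?_
  rw [Finset.sum_comm]
  refine Finset.sum_congr rfl fun j _ => ?_
  rw [Finset.sum_comm]
  have : ∀ k, ∑ a : PauliLabel n, ∑ l, E j i * E l k *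
      ((pauliSign a 0 : ℂ) * (pauli a i j * pauli a k l)) =
      if k = j then 2 ^ n * (E i j * E j i) else 0 := by
    intro k
    rw [Finset.sum_comm]
    simp_rw [← Finset.mul_sum, sum_pauliSign_mul_pauli]
    simp only [pauli_zero, Matrix.one_apply]
    by_cases hk : k = j
    · subst hk; simp; ring
    · simp [hk]
  simp_rw [this]
  simp

/-! ### Positive semidefinite matrices -/

section PosSemidef

variable {d : Type*} [Fintype d]

lemma Matrix.PosSemidef.exists_eq_conjTranspose_mul_self {E : Matrix d d ℂ} (hE : E.PosSemidef) :
    ∃ B : Matrix d d ℂ, E = B.conjTranspose * B := by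
  classical
  open scoped MatrixOrder in
  exact CStarAlgebra.nonneg_iff_eq_star_mul_self.mp hE.nonneg

lemma Matrix.PosSemidef.re_trace_nonneg {E : Matrix d d ℂ} (hE : E.PosSemidef) :
    0 ≤ E.trace.re := (Complex.le_def.mp hE.trace_nonneg).1

lemma Matrix.PosSemidef.re_trace_mul_nonneg {E σ : Matrix d d ℂ} (hE : E.PosSemidef)
    (hσ : σ.PosSemidef) : 0 ≤ (E * σ).trace.re := by
  classical
  obtain ⟨B, rfl⟩ := hE.exists_eq_conjTranspose_mul_self
  rw [Matrix.mul_assoc, Matrix.trace_mul_comm]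
  exact (hσ.mul_mul_conjTranspose_same B).re_trace_nonneg

lemma Matrix.re_trace_conjTranspose_mul_self (A : Matrix d d ℂ) :
    (A.conjTranspose * A).trace.re = ∑ i, ∑ j, ‖A i j‖ ^ 2 := by
  simp only [Matrix.trace, Matrix.diag, Matrix.mul_apply, Matrix.conjTranspose_apply,
    Complex.re_sum]
  rw [Finset.sum_comm]
  refine Finset.sum_congr rfl fun i _ => Finset.sum_congr rfl fun j _ => ?_
  rw [← Complex.normSq_eq_norm_sq]
  simp [Complex.normSq_apply]

/-- With E = A†A and σ = B†B the left side is the squared Frobenius norm of AB†, and Cauchy–Schwarz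
applies entry by entry. -/
lemma Matrix.PosSemidef.re_trace_mul_le {E σ : Matrix d d ℂ} (hE : E.PosSemidef)
    (hσ : σ.PosSemidef) : (E * σ).trace.re ≤ E.trace.re * σ.trace.re := by
  classical
  obtain ⟨A, rfl⟩ := hE.exists_eq_conjTranspose_mul_self
  obtain ⟨B, rfl⟩ := hσ.exists_eq_conjTranspose_mul_self
  have h : (A.conjTranspose * A * (B.conjTranspose * B)).trace =
      ((A * B.conjTranspose).conjTranspose * (A * B.conjTranspose)).trace := by
    rw [Matrix.conjTranspose_mul, Matrix.conjTranspose_conjTranspose, Matrix.mul_assoc B,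
      Matrix.trace_mul_comm B]
    simp only [Matrix.mul_assoc]
  rw [h]
  simp only [Matrix.re_trace_conjTranspose_mul_self]
  rw [Finset.sum_mul]
  refine Finset.sum_le_sum fun i _ => ?_
  rw [Finset.mul_sum]
  refine Finset.sum_le_sum fun j _ => ?_
  have h1 : ‖(A * B.conjTranspose) i j‖ ≤ ∑ k, ‖A i k‖ * ‖B j k‖ := by
    rw [Matrix.mul_apply]
    refine (norm_sum_le _ _).trans (Finset.sum_le_sum fun k _ => ?_)
    simp
  exact (pow_le_pow_left₀ (norm_nonneg _) h1 2).trans (Finset.sum_mul_sq_le_sq_mul_sq _ _ _)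

end PosSemidef

/-! ### Mixtures of conjugations -/

section Conjugation

variable {ι d : Type*} [Fintype ι] [Fintype d]

lemma posSemidef_sum_smul_conj {r : ι → ℝ} (hr : ∀ a, 0 ≤ r a) {U : ι → Matrix d d ℂ}
    (hU : ∀ a, (U a).IsHermitian) {ρ : Matrix d d ℂ} (hρ : ρ.PosSemidef) :
    (∑ a, (r a : ℂ) • (U a * ρ * U a)).PosSemidef := by
  refine Matrix.posSemidef_sum _ fun a _ => ?_
  have h := hρ.mul_mul_conjTranspose_same (U a)
  rw [(hU a).eq] at h
  exact h.smul (by exact_mod_cast hr a)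

lemma trace_sum_smul_conj [DecidableEq d] {r : ι → ℝ} (hr : ∑ a, r a = 1)
    {U : ι → Matrix d d ℂ} (hU : ∀ a, U a * U a = 1) (ρ : Matrix d d ℂ) :
    (∑ a, (r a : ℂ) • (U a * ρ * U a)).trace = ρ.trace := by
  have h : ∀ a, (U a * ρ * U a).trace = ρ.trace := fun a => by
    rw [Matrix.trace_mul_comm, ← Matrix.mul_assoc, hU, Matrix.one_mul]
  simp only [Matrix.trace_sum, Matrix.trace_smul, h, smul_eq_mul]
  rw [← Finset.sum_mul, ← Complex.ofReal_sum, hr]; simp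

end Conjugation

section Ampliation

variable {n : ℕ} {κ : Type*} [DecidableEq κ]

lemma pauli_kronecker_one_isHermitian (a : PauliLabel n) :
    (pauli a ⊗ₖ (1 : Matrix κ κ ℂ)).IsHermitian := by
  rw [Matrix.IsHermitian, Matrix.conjTranspose_kronecker, (pauli_isHermitian a).eq,
    Matrix.conjTranspose_one]

variable [Fintype κ]

lemma pauli_kronecker_one_mul_self (a : PauliLabel n) :
    (pauli a ⊗ₖ (1 : Matrix κ κ ℂ)) * (pauli a ⊗ₖ (1 : Matrix κ κ ℂ)) = 1 := by
  rw [← Matrix.mul_kronecker_mul, pauli_mul_self, Matrix.one_mul, Matrix.one_kronecker_one]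

lemma PauliChannel.posSemidef_applyAux (L : PauliChannel n)
    {ρ : Matrix (Qubits n × κ) (Qubits n × κ) ℂ} (hρ : ρ.PosSemidef) :
    (L.applyAux ρ).PosSemidef :=
  posSemidef_sum_smul_conj L.rate_nonneg pauli_kronecker_one_isHermitian hρ

lemma PauliChannel.trace_applyAux (L : PauliChannel n)
    (ρ : Matrix (Qubits n × κ) (Qubits n × κ) ℂ) : (L.applyAux ρ).trace = ρ.trace :=
  trace_sum_smul_conj L.rate_sum pauli_kronecker_one_mul_self ρ

lemma PauliChannel.posSemidef_apply (L : PauliChannel n)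
    {ρ : Matrix (Qubits n) (Qubits n) ℂ} (hρ : ρ.PosSemidef) : (L.apply ρ).PosSemidef :=
  posSemidef_sum_smul_conj L.rate_nonneg pauli_isHermitian hρ

lemma PauliChannel.trace_apply (L : PauliChannel n)
    (ρ : Matrix (Qubits n) (Qubits n) ℂ) : (L.apply ρ).trace = ρ.trace :=
  trace_sum_smul_conj L.rate_sum pauli_mul_self ρ

end Ampliation

lemma QChannel.posSemidef_map {d : Type*} [Fintype d] (C : QChannel d) {X : Matrix d d ℂ}
    (hX : X.PosSemidef) : (C.map X).PosSemidef :=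
  (C.completelyPositive 1 (X.submatrix Prod.fst Prod.fst) (hX.submatrix _)).submatrix
    fun i => (i, 0)

/-! ### Outcome probabilities -/

section Probabilities

variable {d : Type*} [Fintype d] [DecidableEq d] {O : Type*} [Fintype O] (E : POVM d O)

lemma POVM.prob_nonneg {ρ : Matrix d d ℂ} (hρ : ρ.PosSemidef) (o : O) : 0 ≤ E.prob ρ o :=
  (E.posSemidef o).re_trace_mul_nonneg hρ

lemma POVM.prob_le_trace {ρ : Matrix d d ℂ} (hρ : ρ.PosSemidef) (ht : ρ.trace = 1) (o : O) :
    E.prob ρ o ≤ (E.effect o).trace.re := by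
  simpa [ht, POVM.prob] using (E.posSemidef o).re_trace_mul_le hρ

lemma POVM.sum_prob {ρ : Matrix d d ℂ} (ht : ρ.trace = 1) : ∑ o, E.prob ρ o = 1 := by
  simp only [POVM.prob]
  rw [← Complex.re_sum, ← Matrix.trace_sum, ← Finset.sum_mul, E.sum_eq_one, Matrix.one_mul, ht,
    Complex.one_re]

lemma POVM.sum_trace : ∑ o, (E.effect o).trace.re = Fintype.card d := by
  rw [← Complex.re_sum, ← Matrix.trace_sum, E.sum_eq_one, Matrix.trace_one, Complex.natCast_re]

lemma POVM.prob_sum_smul {ι : Type*} [Fintype ι] (r : ι → ℝ) (ρ : ι → Matrix d d ℂ) (o : O) :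
    E.prob (∑ a, (r a : ℂ) • ρ a) o = ∑ a, r a * E.prob (ρ a) o := by
  simp [POVM.prob, Matrix.mul_sum, Matrix.trace_sum]

end Probabilities

/-! ### The hard family of channels -/

/-- Eigenvalues of the hard channels away from `0` and the marked label are `-pauliGap n`. -/
def pauliGap (n : ℕ) : ℝ := 1 / (2 * 4 ^ n)

lemma pauliGap_pos (n : ℕ) : 0 < pauliGap n := by unfold pauliGap; positivity

lemma pauliGap_mul (n : ℕ) : pauliGap n * 4 ^ n = 1 / 2 := by unfold pauliGap; field_simp

lemma pauliGap_le (n : ℕ) : pauliGap n ≤ 1 / 2 := by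
  nlinarith [pauliGap_mul n, pauliGap_pos n, one_le_pow₀ (n := n) (show (1 : ℝ) ≤ 4 by norm_num)]

/-- The channel with eigenvalue `1` at `0` and eigenvalue `-pauliGap n` everywhere else. -/
def backgroundChannel (n : ℕ) : PauliChannel n where
  rate a := (1 + pauliGap n) / 4 ^ n - if a = 0 then pauliGap n else 0
  rate_nonneg a := by
    have h : pauliGap n ≤ (1 + pauliGap n) / 4 ^ n := by
      rw [le_div_iff₀ (by positivity), pauliGap_mul]; linarith [pauliGap_pos n]
    have := pauliGap_pos n
    split_ifs <;> linarith
  rate_sum := by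
    simp [Finset.sum_sub_distrib, mul_div_cancel₀]

/-- The channel with eigenvalue `1` at `0` and at `b`, and eigenvalue `-pauliGap n` everywhere
else. -/
def markedChannel {n : ℕ} (b : {b : PauliLabel n // b ≠ 0}) : PauliChannel n where
  rate a := (1 + pauliGap n) / 4 ^ n * (1 + pauliSign a b) - if a = 0 then pauliGap n else 0
  rate_nonneg a := by
    have h : pauliGap n ≤ (1 + pauliGap n) / 4 ^ n := by
      rw [le_div_iff₀ (by positivity), pauliGap_mul]; linarith [pauliGap_pos n]
    have := pauliGap_pos n
    split_ifs with ha
    · subst ha; rw [pauliSign_zero_left]; linarith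
    · nlinarith [neg_one_le_pauliSign a b.1]
  rate_sum := by
    simp [Finset.sum_sub_distrib, mul_add, Finset.sum_add_distrib, ← Finset.mul_sum,
      sum_pauliSign, b.2, mul_div_cancel₀]

lemma markedChannel_rate {n : ℕ} (b : {b : PauliLabel n // b ≠ 0}) (a : PauliLabel n) :
    (markedChannel b).rate a =
      (backgroundChannel n).rate a + (1 + pauliGap n) / 4 ^ n * pauliSign a b := by
  simp only [markedChannel, backgroundChannel]; ring

/-- Since `pauliGap n` is half of 1/4^n, subtracting it at label 0 leaves at least half of the
uniform weight. This lower bound makes the background usable as a reference, both for χ² and for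
domination. -/
lemma inv_le_backgroundChannel_rate {n : ℕ} (a : PauliLabel n) :
    1 / (2 * 4 ^ n) ≤ (backgroundChannel n).rate a := by
  have h : pauliGap n + 1 / (2 * 4 ^ n) ≤ (1 + pauliGap n) / 4 ^ n := by
    rw [← pauliGap, le_div_iff₀ (by positivity), add_mul, pauliGap_mul]; linarith [pauliGap_pos n]
  have := pauliGap_pos n
  simp only [backgroundChannel]
  split_ifs <;> linarith

lemma markedChannel_rate_le {n : ℕ} (b : {b : PauliLabel n // b ≠ 0}) (a : PauliLabel n) :
    (markedChannel b).rate a ≤ 4 * (backgroundChannel n).rate a := by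
  rw [markedChannel_rate]
  have h : (1 + pauliGap n) / 4 ^ n ≤ 3 * (1 / (2 * 4 ^ n)) := by
    rw [div_le_iff₀ (by positivity), ← pauliGap, mul_assoc, pauliGap_mul]
    linarith [pauliGap_le n]
  have h0 : 0 ≤ (1 + pauliGap n) / 4 ^ n := by have := pauliGap_pos n; positivity
  nlinarith [inv_le_backgroundChannel_rate a, pauliSign_le_one a b.1]

lemma markedChannel_eigenvalue {n : ℕ} (b : {b : PauliLabel n // b ≠ 0}) {c : PauliLabel n}
    (hc : c ≠ 0) :
    (markedChannel b).eigenvalue c = if c = b.1 then 1 else -pauliGap n := by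
  have h : (markedChannel b).eigenvalue c =
      (1 + pauliGap n) / 4 ^ n * ∑ a, pauliSign a c +
      (1 + pauliGap n) / 4 ^ n * ∑ a, pauliSign a c * pauliSign a b -
      ∑ a : PauliLabel n, if a = 0 then pauliGap n else 0 := by
    simp only [PauliChannel.eigenvalue, markedChannel, Finset.mul_sum]
    rw [← Finset.sum_add_distrib, ← Finset.sum_sub_distrib]
    refine Finset.sum_congr rfl fun a _ => ?_
    change _ * pauliSign a c = _
    split_ifs with ha
    · subst ha; simp; ring
    · ring
  rw [h, sum_pauliSign, sum_pauliSign_mul]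
  split_ifs <;> simp_all

/-- No estimate is good for two hard channels. -/
lemma goodEstimate_markedChannel_inj {n : ℕ} {b c : {b : PauliLabel n // b ≠ 0}}
    {est : PauliLabel n → ℝ} (hb : GoodEstimate (markedChannel b) est)
    (hc : GoodEstimate (markedChannel c) est) : b = c := by
  by_contra hne
  have h1 := hb b
  have h2 := hc b
  rw [markedChannel_eigenvalue _ b.2, if_pos rfl] at h1
  rw [markedChannel_eigenvalue _ b.2, if_neg fun h => hne (Subtype.ext h)] at h2
  -- The two eigenvalues at b differ by 1 + `pauliGap n`, strictly more than twice the tolerance.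
  -- With 0 in place of −`pauliGap n`, the estimate 1/2 would be good for both.
  have := pauliGap_pos n
  rw [abs_le] at h1 h2
  linarith

lemma card_ne_zero_label (n : ℕ) :
    (Fintype.card {b : PauliLabel n // b ≠ 0} : ℝ) = 4 ^ n - 1 := by
  rw [Fintype.card_subtype_compl, card_pauliLabel, Fintype.card_subtype_eq]
  rw [Nat.cast_sub (Nat.one_le_pow _ _ (by norm_num))]; simp

open Classical in
/-- The records whose estimate is good for the hard channels are disjoint events. -/
lemma sum_sum_goodEstimate_le {n : ℕ} {R : Type*} [Fintype R] (est : R → PauliLabel n → ℝ)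
    {Q : R → ℝ} (hQ : ∀ r, 0 ≤ Q r) (hQ1 : ∑ r, Q r = 1) :
    ∑ b : {b : PauliLabel n // b ≠ 0}, ∑ r with GoodEstimate (markedChannel b) (est r), Q r
      ≤ 1 := by
  rw [← hQ1, ← Finset.sum_biUnion]
  · exact Finset.sum_le_sum_of_subset_of_nonneg (Finset.subset_univ _) fun r _ _ => hQ r
  · intro b _ c _ hne
    rw [Function.onFun, Finset.disjoint_left]
    intro r hr hr'
    exact hne (goodEstimate_markedChannel_inj (Finset.mem_filter.mp hr).2
      (Finset.mem_filter.mp hr').2)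

lemma sum_label_ne_zero_le {n : ℕ} {f : PauliLabel n → ℝ} (hf : ∀ b, 0 ≤ f b) :
    ∑ b : {b : PauliLabel n // b ≠ 0}, f b ≤ ∑ b, f b := by
  rw [← Finset.sum_subtype (Finset.univ.filter fun b : PauliLabel n => b ≠ 0) (by simp) f]
  exact Finset.sum_le_sum_of_subset_of_nonneg (Finset.subset_univ _) fun b _ _ => hf b

/-! ### One measurement of the hard channels -/

/-- The difference is (1 + ε)/4^n times the Fourier coefficient of g at b. Parseval leaves Σ g² ≤ T
Σ g, and Σ g is controlled by the lower bound on the background rates. -/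
lemma sum_sq_sum_markedChannel_rate_sub_le {n : ℕ} {g : PauliLabel n → ℝ} {T : ℝ}
    (hg0 : ∀ a, 0 ≤ g a) (hgT : ∀ a, g a ≤ T) :
    ∑ b, (∑ a, (markedChannel b).rate a * g a - ∑ a, (backgroundChannel n).rate a * g a) ^ 2 ≤
      8 * T * ∑ a, (backgroundChannel n).rate a * g a := by
  have hT0 : 0 ≤ T := (hg0 0).trans (hgT 0)
  have hdiff : ∀ b : {b : PauliLabel n // b ≠ 0},
      ∑ a, (markedChannel b).rate a * g a - ∑ a, (backgroundChannel n).rate a * g a =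
      (1 + pauliGap n) / 4 ^ n * ∑ a, pauliSign a b * g a := by
    intro b
    rw [← Finset.sum_sub_distrib, Finset.mul_sum]
    exact Finset.sum_congr rfl fun a _ => by rw [markedChannel_rate]; ring
  have hsum : ∑ a, g a ^ 2 ≤ T * ∑ a, g a := by
    rw [Finset.mul_sum]
    exact Finset.sum_le_sum fun a _ => by nlinarith [hg0 a, hgT a]
  have hQ : 1 / (2 * 4 ^ n) * ∑ a, g a ≤ ∑ a, (backgroundChannel n).rate a * g a := by
    rw [Finset.mul_sum]
    exact Finset.sum_le_sum fun a _ =>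
      mul_le_mul_of_nonneg_right (inv_le_backgroundChannel_rate a) (hg0 a)
  have hG : (4 : ℝ) ^ n ≠ 0 := by positivity
  calc _ = ((1 + pauliGap n) / 4 ^ n) ^ 2 * ∑ b : {b : PauliLabel n // b ≠ 0},
          (∑ a, pauliSign a b * g a) ^ 2 := by
        simp_rw [hdiff, mul_pow]; rw [← Finset.mul_sum]
    _ ≤ ((1 + pauliGap n) / 4 ^ n) ^ 2 * ∑ b, (∑ a, pauliSign a b * g a) ^ 2 :=
        mul_le_mul_of_nonneg_left
          (sum_label_ne_zero_le (f := fun b => (∑ a, pauliSign a b * g a) ^ 2)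
            fun b => sq_nonneg _) (sq_nonneg _)
    _ = (1 + pauliGap n) ^ 2 * (1 / 4 ^ n) * ∑ a, g a ^ 2 := by
        rw [sum_sq_sum_pauliSign_mul]
        generalize (4 : ℝ) ^ n = G at hG
        field_simp
    _ ≤ 4 * (1 / 4 ^ n) * (T * ∑ a, g a) := by
        have : (1 + pauliGap n) ^ 2 ≤ 4 := by nlinarith [pauliGap_le n, pauliGap_pos n]
        have h0 : 0 ≤ ∑ a, g a ^ 2 := Finset.sum_nonneg fun a _ => sq_nonneg _
        gcongr
    _ = 8 * T * (1 / (2 * 4 ^ n) * ∑ a, g a) := by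
        generalize (4 : ℝ) ^ n = G at hG
        field_simp; ring
    _ ≤ _ := mul_le_mul_of_nonneg_left hQ (by positivity)

section OneStep

variable {n : ℕ} {κ : Type*} [Fintype κ] [DecidableEq κ] {O : Type*} [Fintype O]

lemma POVM.sum_sq_prob_applyAux_sub_le (E : POVM (Qubits n × κ) O) (ρ : QState (Qubits n × κ))
    (o : O) :
    ∑ b, (E.prob ((markedChannel b).applyAux ρ.mat) o -
        E.prob ((backgroundChannel n).applyAux ρ.mat) o) ^ 2 ≤
      8 * (E.effect o).trace.re * E.prob ((backgroundChannel n).applyAux ρ.mat) o := by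
  have hprob : ∀ L : PauliChannel n, E.prob (L.applyAux ρ.mat) o = ∑ a, L.rate a *
      E.prob ((pauli a ⊗ₖ (1 : Matrix κ κ ℂ)) * ρ.mat * (pauli a ⊗ₖ (1 : Matrix κ κ ℂ))) o :=
    fun L => E.prob_sum_smul L.rate _ o
  have hstate : ∀ a : PauliLabel n, ((pauli a ⊗ₖ (1 : Matrix κ κ ℂ)) * ρ.mat *
      (pauli a ⊗ₖ (1 : Matrix κ κ ℂ))).PosSemidef := fun a => by
    have h := ρ.posSemidef.mul_mul_conjTranspose_same (pauli a ⊗ₖ (1 : Matrix κ κ ℂ))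
    rwa [(pauli_kronecker_one_isHermitian a).eq] at h
  have htr : ∀ a : PauliLabel n, ((pauli a ⊗ₖ (1 : Matrix κ κ ℂ)) * ρ.mat *
      (pauli a ⊗ₖ (1 : Matrix κ κ ℂ))).trace = 1 := fun a => by
    rw [Matrix.trace_mul_comm, ← Matrix.mul_assoc, pauli_kronecker_one_mul_self, Matrix.one_mul,
      ρ.trace_eq_one]
  simp_rw [hprob]
  exact sum_sq_sum_markedChannel_rate_sub_le (fun a => E.prob_nonneg (hstate a) o)
    (fun a => E.prob_le_trace (hstate a) (htr a) o)

/-- Outcomes impossible under the background are impossible under every marked channel, so the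
convention x / 0 = 0 loses nothing in the χ² sums. -/
lemma POVM.prob_applyAux_sub_eq_zero (E : POVM (Qubits n × κ) O) (ρ : QState (Qubits n × κ))
    {o : O} (ho : E.prob ((backgroundChannel n).applyAux ρ.mat) o = 0)
    (b : {b : PauliLabel n // b ≠ 0}) :
    E.prob ((markedChannel b).applyAux ρ.mat) o -
        E.prob ((backgroundChannel n).applyAux ρ.mat) o = 0 := by
  have h := E.sum_sq_prob_applyAux_sub_le ρ o
  rw [ho, mul_zero] at h
  have h1 := (Finset.single_le_sum (f := fun b => (E.prob ((markedChannel b).applyAux ρ.mat) o -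
    0) ^ 2) (fun b _ => sq_nonneg _) (Finset.mem_univ b)).trans h
  rw [ho]
  exact pow_eq_zero_iff two_ne_zero |>.mp (le_antisymm h1 (sq_nonneg _))

/-- The total `χ²`-information that one measurement carries about the hard channels. -/
lemma POVM.sum_chiSq_le (E : POVM (Qubits n × κ) O) (ρ : QState (Qubits n × κ)) :
    ∑ b, ∑ o, (E.prob ((markedChannel b).applyAux ρ.mat) o -
        E.prob ((backgroundChannel n).applyAux ρ.mat) o) ^ 2 /
          E.prob ((backgroundChannel n).applyAux ρ.mat) o ≤
      8 * (2 ^ n * Fintype.card κ) := by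
  have hcard : ∑ o, (E.effect o).trace.re = 2 ^ n * Fintype.card κ := by
    rw [E.sum_trace]; simp
  rw [Finset.sum_comm, ← hcard, Finset.mul_sum]
  refine Finset.sum_le_sum fun o _ => ?_
  rw [← Finset.sum_div]
  have h0 : 0 ≤ E.prob ((backgroundChannel n).applyAux ρ.mat) o :=
    E.prob_nonneg ((backgroundChannel n).posSemidef_applyAux ρ.posSemidef) o
  exact div_le_of_le_mul₀ h0 (mul_nonneg (by norm_num) (E.posSemidef o).re_trace_nonneg)
    (E.sum_sq_prob_applyAux_sub_le ρ o)

lemma POVM.sum_prob_applyAux (E : POVM (Qubits n × κ) O) (ρ : QState (Qubits n × κ))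
    (L : PauliChannel n) : ∑ o, E.prob (L.applyAux ρ.mat) o = 1 :=
  E.sum_prob (by rw [L.trace_applyAux, ρ.trace_eq_one])

lemma POVM.prob_applyAux_nonneg (E : POVM (Qubits n × κ) O) (ρ : QState (Qubits n × κ))
    (L : PauliChannel n) (o : O) : 0 ≤ E.prob (L.applyAux ρ.mat) o :=
  E.prob_nonneg (L.posSemidef_applyAux ρ.posSemidef) o

/-- Cauchy–Schwarz over pairs (b, o) with weight Q(o). The total weight is the number of nonzero
labels, because Q is repeated for every b. -/
lemma POVM.sum_abs_prob_applyAux_sub_le (E : POVM (Qubits n × κ) O)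
    (ρ : QState (Qubits n × κ)) :
    ∑ b, ∑ o, |E.prob ((markedChannel b).applyAux ρ.mat) o -
        E.prob ((backgroundChannel n).applyAux ρ.mat) o| ≤
      √(4 ^ n * (8 * (2 ^ n * Fintype.card κ))) := by
  refine Real.le_sqrt_of_sq_le ?_
  rw [← Fintype.sum_prod_type']
  set D : {b : PauliLabel n // b ≠ 0} × O → ℝ := fun x =>
    E.prob ((markedChannel x.1).applyAux ρ.mat) x.2 -
        E.prob ((backgroundChannel n).applyAux ρ.mat) x.2
  set Q : {b : PauliLabel n // b ≠ 0} × O → ℝ := fun x =>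
    E.prob ((backgroundChannel n).applyAux ρ.mat) x.2
  have hQ0 : ∀ x, 0 ≤ Q x := fun x => E.prob_applyAux_nonneg ρ _ _
  have hcs : (∑ x, |D x|) ^ 2 ≤ (∑ x, Q x) * ∑ x, D x ^ 2 / Q x := by
    refine Finset.sum_sq_le_sum_mul_sum_of_sq_le_mul _ (fun x _ => hQ0 x)
      (fun x _ => div_nonneg (sq_nonneg _) (hQ0 x)) fun x _ => ?_
    rw [sq_abs]
    by_cases hx : Q x = 0
    · have h : D x = 0 := E.prob_applyAux_sub_eq_zero ρ hx x.1
      rw [h, hx]; simp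
    · exact (mul_div_cancel₀ _ hx).ge
  refine hcs.trans (mul_le_mul ?_ ?_ (Finset.sum_nonneg fun x _ => div_nonneg (sq_nonneg _) (hQ0 x))
    (by positivity))
  · rw [Fintype.sum_prod_type]
    simp only [Q, E.sum_prob_applyAux]
    rw [Finset.sum_const, Finset.card_univ, nsmul_eq_mul, card_ne_zero_label]
    linarith
  · rw [Fintype.sum_prod_type]
    exact E.sum_chiSq_le ρ

end OneStep

/-! ### One round of a concatenated, ancilla-free experiment -/

lemma trace_mul_eq_ofReal {d : Type*} [Fintype d] {A B : Matrix d d ℂ} (hA : A.IsHermitian)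
    (hB : B.IsHermitian) : (A * B).trace = ((A * B).trace.re : ℂ) := by
  have h : star (A * B).trace = (A * B).trace := by
    rw [← Matrix.trace_conjTranspose, Matrix.conjTranspose_mul, hA.eq, hB.eq,
      Matrix.trace_mul_comm]
  exact (Complex.conj_eq_iff_re.mp h).symm

/-- For s = ±1 one has (1 + sP)² = 2(1 + sP), so 1 ± P is positive semidefinite and pairs
nonnegatively with σ. -/
lemma abs_re_trace_pauli_mul_le {n : ℕ} (b : PauliLabel n) {σ : Matrix (Qubits n) (Qubits n) ℂ}
    (hσ : σ.PosSemidef) (ht : σ.trace = 1) : |(pauli b * σ).trace.re| ≤ 1 := by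
  have key : ∀ s : ℝ, s * s = 1 → 0 ≤ 1 + s * (pauli b * σ).trace.re := by
    intro s hs
    have h := Matrix.posSemidef_conjTranspose_mul_self (1 + (s : ℂ) • pauli b)
    have h2 : (1 + (s : ℂ) • pauli b).conjTranspose * (1 + (s : ℂ) • pauli b) =
        (2 : ℂ) • (1 + (s : ℂ) • pauli b) := by
      rw [Matrix.conjTranspose_add, Matrix.conjTranspose_smul, (pauli_isHermitian b).eq,
        Matrix.conjTranspose_one]
      simp only [RCLike.star_def, Complex.conj_ofReal, add_mul, mul_add, Matrix.smul_mul,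
        Matrix.mul_smul, pauli_mul_self, smul_smul, one_mul, mul_one]
      rw [← Complex.ofReal_mul, hs, Complex.ofReal_one, one_smul]
      module
    rw [h2] at h
    have h3 := h.re_trace_mul_nonneg hσ
    simp [add_mul, ht] at h3
    linarith
  have h1 := key 1 (by norm_num)
  have h2 := key (-1) (by norm_num)
  rw [abs_le]; constructor <;> linarith

/-- A hard channel retains one bit of its input, up to a small error. -/
lemma markedChannel_apply {n : ℕ} (b : {b : PauliLabel n // b ≠ 0})
    (σ : Matrix (Qubits n) (Qubits n) ℂ) :
    (markedChannel b).apply σ =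
      (((1 + pauliGap n) / 2 ^ n : ℝ) : ℂ) • (σ.trace • (1 : Matrix (Qubits n) (Qubits n) ℂ) +
        (pauli b.1 * σ).trace • pauli b.1) - (pauliGap n : ℂ) • σ := by
  have h : (markedChannel b).apply σ =
      (((1 + pauliGap n) / 4 ^ n : ℝ) : ℂ) • ∑ a, (pauliSign a 0 : ℂ) • (pauli a * σ * pauli a) +
      (((1 + pauliGap n) / 4 ^ n : ℝ) : ℂ) • ∑ a, (pauliSign a b : ℂ) • (pauli a * σ * pauli a) -
      ∑ a : PauliLabel n, if a = 0 then (pauliGap n : ℂ) • σ else 0 := by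
    rw [Finset.smul_sum, Finset.smul_sum, ← Finset.sum_add_distrib, ← Finset.sum_sub_distrib]
    refine Finset.sum_congr rfl fun a _ => ?_
    simp only [markedChannel, pauliSign_zero_right]
    split_ifs with ha
    · subst ha
      simp only [pauli_zero, one_mul, mul_one]
      push_cast
      module
    · push_cast
      module
  have h4 : (4 : ℂ) ^ n = 2 ^ n * 2 ^ n := by rw [← mul_pow]; norm_num
  rw [h, sum_pauliSign_smul_conj, sum_pauliSign_smul_conj]
  simp only [pauli_zero, one_mul, Finset.sum_ite_eq', Finset.mem_univ, if_true]
  rw [smul_add, smul_smul, smul_smul, smul_smul, smul_smul]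
  push_cast
  rw [h4]
  congr 3 <;> field_simp

/-- Cauchy–Schwarz over the 4^n labels, then Parseval and Tr E² ≤ (Tr E)². -/
lemma sum_abs_re_trace_mul_pauli_le {n : ℕ} {E : Matrix (Qubits n) (Qubits n) ℂ}
    (hE : E.PosSemidef) :
    ∑ b, |(E * pauli b).trace.re| ≤ 2 ^ n * √(2 ^ n) * E.trace.re := by
  have hreal := fun b : PauliLabel n => trace_mul_eq_ofReal hE.1 (pauli_isHermitian b)
  have hpars : ∑ b, (E * pauli b).trace.re ^ 2 ≤ 2 ^ n * E.trace.re ^ 2 := by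
    have h := congrArg Complex.re (sum_trace_mul_pauli_sq E)
    rw [Complex.re_sum] at h
    have h2 : ∀ b : PauliLabel n, ((E * pauli b).trace ^ 2).re = (E * pauli b).trace.re ^ 2 := by
      intro b
      rw [hreal b, ← Complex.ofReal_pow, Complex.ofReal_re, Complex.ofReal_re]
    simp_rw [h2] at h
    rw [h]
    have h3 : ((2 : ℂ) ^ n * (E * E).trace).re = 2 ^ n * (E * E).trace.re := by
      rw [show (2 : ℂ) ^ n = ((2 ^ n : ℝ) : ℂ) by push_cast; rfl, Complex.re_ofReal_mul]
    rw [h3, sq]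
    exact mul_le_mul_of_nonneg_left (hE.re_trace_mul_le hE) (by positivity)
  have hcs := sq_sum_le_card_mul_sum_sq (s := (Finset.univ : Finset (PauliLabel n)))
    (f := fun b => |(E * pauli b).trace.re|)
  rw [Finset.card_univ, card_pauliLabel] at hcs
  simp only [sq_abs] at hcs
  refine le_of_sq_le_sq ?_ (mul_nonneg (by positivity) hE.re_trace_nonneg)
  have h4 : (4 : ℝ) ^ n = (2 ^ n) ^ 2 := by rw [← pow_mul, mul_comm, pow_mul]; norm_num
  push_cast at hcs
  calc _ ≤ (4 : ℝ) ^ n * ∑ b, (E * pauli b).trace.re ^ 2 := hcs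
    _ ≤ 4 ^ n * (2 ^ n * E.trace.re ^ 2) := by gcongr
    _ = (2 ^ n * √(2 ^ n) * E.trace.re) ^ 2 := by
      rw [mul_pow, mul_pow, Real.sq_sqrt (by positivity), h4]; ring

/-- The input may depend on b, as it must after earlier uses of the channel: it enters only through
the coefficient Tr(P_b σ), at most 1 in modulus, and an error of order ε. -/
lemma POVM.sum_abs_prob_markedChannel_apply_sub_le {n : ℕ} {O : Type*} [Fintype O]
    (E : POVM (Qubits n) O)
    {σ : {b : PauliLabel n // b ≠ 0} → Matrix (Qubits n) (Qubits n) ℂ}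
    (hσ : ∀ b, (σ b).PosSemidef) (ht : ∀ b, (σ b).trace = 1) :
    ∑ b, ∑ o, |E.prob ((markedChannel b).apply (σ b)) o - (E.effect o).trace.re / 2 ^ n| ≤
      3 * (2 ^ n * √(2 ^ n)) := by
  have hε := pauliGap_pos n
  have hpow : (1 : ℝ) ≤ 2 ^ n := one_le_pow₀ (by norm_num)
  have hstep : ∀ b o, |E.prob ((markedChannel b).apply (σ b)) o - (E.effect o).trace.re / 2 ^ n| ≤
      pauliGap n * ((E.effect o).trace.re / 2 ^ n) +
        2 / 2 ^ n * |(E.effect o * pauli b.1).trace.re| + pauliGap n * E.prob (σ b) o := by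
    intro b o
    set T := (E.effect o).trace.re
    set s := (E.effect o * pauli b.1).trace.re with hs
    set t := (pauli b.1 * σ b).trace.re with htt
    have e : E.prob ((markedChannel b).apply (σ b)) o =
        (1 + pauliGap n) / 2 ^ n * (T + t * s) - pauliGap n * E.prob (σ b) o := by
      rw [POVM.prob, markedChannel_apply, ht, trace_mul_eq_ofReal (pauli_isHermitian b.1) (hσ b).1]
      simp only [Matrix.mul_sub, Matrix.mul_smul, Matrix.mul_add, Matrix.trace_sub,
        Matrix.trace_smul, Matrix.trace_add, smul_eq_mul, Complex.sub_re, Complex.re_ofReal_mul,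
        Complex.add_re, one_smul, mul_one, POVM.prob]
      rfl
    have hq : 0 ≤ E.prob (σ b) o := E.prob_nonneg (hσ b) o
    have hT : 0 ≤ T / 2 ^ n := div_nonneg (E.posSemidef o).re_trace_nonneg (by positivity)
    have e2 : E.prob ((markedChannel b).apply (σ b)) o - T / 2 ^ n =
        pauliGap n * (T / 2 ^ n) + (1 + pauliGap n) / 2 ^ n * (t * s) -
          pauliGap n * E.prob (σ b) o := by rw [e]; ring
    have hts : |(1 + pauliGap n) / 2 ^ n * (t * s)| ≤ 2 / 2 ^ n * |s| := by
      rw [abs_mul, abs_mul, abs_of_nonneg (by positivity : 0 ≤ (1 + pauliGap n) / 2 ^ n)]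
      have h1 : |t| ≤ 1 := abs_re_trace_pauli_mul_le b.1 (hσ b) (ht b)
      have h2 : 1 + pauliGap n ≤ 2 := by linarith [pauliGap_le n]
      refine mul_le_mul (by gcongr) (mul_le_of_le_one_left (abs_nonneg s) h1) (by positivity)
        (by positivity)
    rw [e2]
    have h1 := abs_le.mp hts
    have h2 : 0 ≤ pauliGap n * (T / 2 ^ n) := by positivity
    have h3 : 0 ≤ pauliGap n * E.prob (σ b) o := by positivity
    rw [abs_le]
    constructor <;> linarith
  have htrace : ∑ o, (E.effect o).trace.re = 2 ^ n := by rw [E.sum_trace]; simp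
  calc _ ≤ ∑ b : {b : PauliLabel n // b ≠ 0}, ∑ o, (pauliGap n * ((E.effect o).trace.re / 2 ^ n) +
        2 / 2 ^ n * |(E.effect o * pauli b.1).trace.re| + pauliGap n * E.prob (σ b) o) :=
        Finset.sum_le_sum fun b _ => Finset.sum_le_sum fun o _ => hstep b o
    _ = ∑ b : {b : PauliLabel n // b ≠ 0}, (2 * pauliGap n) +
        2 / 2 ^ n * ∑ o, ∑ b : {b : PauliLabel n // b ≠ 0},
          |(E.effect o * pauli b.1).trace.re| := by
        rw [Finset.sum_comm (s := (Finset.univ : Finset O)), Finset.mul_sum,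
          ← Finset.sum_add_distrib]
        refine Finset.sum_congr rfl fun b _ => ?_
        rw [Finset.sum_add_distrib, Finset.sum_add_distrib, ← Finset.mul_sum, ← Finset.mul_sum,
          ← Finset.mul_sum, ← Finset.sum_div, htrace, E.sum_prob (ht b),
          div_self (by positivity)]
        ring
    -- The error terms amount to 2ε per label, hence at most 2ε·4^n = 1 in total.
    _ ≤ 1 + 2 / 2 ^ n * ∑ o, 2 ^ n * √(2 ^ n) * (E.effect o).trace.re := by
        refine add_le_add ?_ (mul_le_mul_of_nonneg_left (Finset.sum_le_sum fun o _ => ?_)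
          (by positivity))
        · rw [Finset.sum_const, Finset.card_univ, nsmul_eq_mul, card_ne_zero_label]
          nlinarith [pauliGap_mul n]
        · exact (sum_label_ne_zero_le fun b => abs_nonneg _).trans
            (sum_abs_re_trace_mul_pauli_le (E.posSemidef o))
    _ = 1 + 2 * (2 ^ n * √(2 ^ n)) := by
        rw [← Finset.mul_sum, htrace]; field_simp
    _ ≤ _ := by
        have : 1 ≤ √(2 ^ n : ℝ) := Real.one_le_sqrt.mpr hpow
        nlinarith

/-! ### Adaptive sequences of measurements -/

section Adaptive

variable {O : Type*}

/-- The probability of a record of outcomes, from the conditional probabilities of each outcome. -/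
def recordProb {N : ℕ} (K : (i : Fin N) → (Fin i → O) → O → ℝ) (o : Fin N → O) : ℝ :=
  ∏ i, K i (history o i) (o i)

lemma recordProb_snoc {N : ℕ} (K : (i : Fin (N + 1)) → (Fin i → O) → O → ℝ) (h : Fin N → O)
    (x : O) :
    recordProb K (Fin.snoc (α := fun _ => O) h x) =
      recordProb (fun i : Fin N => K i.castSucc) h * K (Fin.last N) h x := by
  -- The history of the extended record agrees with that of `h` only propositionally; generalizing
  -- it to a variable allows the substitution.
  have key : ∀ (i : Fin N) (y : Fin i → O) (z : O), y = history h i → z = h i →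
      K i.castSucc y z = K i.castSucc (history h i) (h i) := by
    rintro i _ _ rfl rfl; rfl
  rw [recordProb, Fin.prod_univ_castSucc]
  congr 1
  · refine Finset.prod_congr rfl fun i _ => key i _ _ ?_ (Fin.snoc_castSucc ..)
    funext j
    exact Fin.snoc_castSucc (α := fun _ => O) x h (Fin.castLE i.isLt.le j)
  · have key2 : ∀ (y : Fin N → O) (z : O), y = h → z = x →
        K (Fin.last N) y z = K (Fin.last N) h x := by
      rintro _ _ rfl rfl; rfl
    refine key2 _ _ ?_ (Fin.snoc_last ..)
    funext j
    exact Fin.snoc_castSucc (α := fun _ => O) x h j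

lemma recordProb_nonneg {N : ℕ} {K : (i : Fin N) → (Fin i → O) → O → ℝ}
    (hK : ∀ i h x, 0 ≤ K i h x) (o : Fin N → O) : 0 ≤ recordProb K o :=
  Finset.prod_nonneg fun i _ => hK i _ _

variable [Fintype O]

lemma sum_fin_succ_pi {N : ℕ} (F : (Fin (N + 1) → O) → ℝ) :
    ∑ o, F o = ∑ h : Fin N → O, ∑ x, F (Fin.snoc (α := fun _ => O) h x) := by
  rw [← (Fin.snocEquiv fun _ => O).sum_comp, Fintype.sum_prod_type, Finset.sum_comm]
  rfl

lemma sum_recordProb {N : ℕ} {K : (i : Fin N) → (Fin i → O) → O → ℝ}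
    (hK : ∀ i h, ∑ x, K i h x = 1) : ∑ o, recordProb K o = 1 := by
  induction N with
  | zero => simp [recordProb]
  | succ N ih =>
    rw [sum_fin_succ_pi]
    simp_rw [recordProb_snoc, ← Finset.mul_sum, hK, mul_one]
    exact ih fun i => hK i.castSucc

/-- The hybrid argument: the total variation distances to a reference adaptive experiment,
summed over a family of hypotheses, grow at most linearly in the number of rounds. -/
lemma sum_abs_recordProb_sub_le {B : Type*} [Fintype B] {N : ℕ}
    {K : B → (i : Fin N) → (Fin i → O) → O → ℝ} {Q : (i : Fin N) → (Fin i → O) → O → ℝ}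
    (hK : ∀ b i h x, 0 ≤ K b i h x) (hK1 : ∀ b i h, ∑ x, K b i h x = 1)
    (hQ : ∀ i h x, 0 ≤ Q i h x) (hQ1 : ∀ i h, ∑ x, Q i h x = 1) {Δ : ℝ}
    (hΔ : ∀ i h, ∑ b, ∑ x, |K b i h x - Q i h x| ≤ Δ) :
    ∑ b, ∑ o, |recordProb (K b) o - recordProb Q o| ≤ N * Δ := by
  induction N with
  | zero => simp [recordProb]
  | succ N ih =>
    set K' : B → (i : Fin N) → (Fin i → O) → O → ℝ := fun b i => K b i.castSucc
    set Q' : (i : Fin N) → (Fin i → O) → O → ℝ := fun i => Q i.castSucc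
    have hIH := ih (K := K') (Q := Q') (fun b i => hK b i.castSucc) (fun b i => hK1 b i.castSucc)
      (fun i => hQ i.castSucc) (fun i => hQ1 i.castSucc) fun i => hΔ i.castSucc
    have hQ'0 : ∀ h, 0 ≤ recordProb Q' h := recordProb_nonneg fun i => hQ i.castSucc
    have hQ'1 : ∑ h, recordProb Q' h = 1 := sum_recordProb fun i => hQ1 i.castSucc
    have hstep : ∀ b (h : Fin N → O), ∑ x, |recordProb (K b) (Fin.snoc (α := fun _ => O) h x) -
        recordProb Q (Fin.snoc (α := fun _ => O) h x)| ≤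
        |recordProb (K' b) h - recordProb Q' h| +
          recordProb Q' h * ∑ x, |K b (Fin.last N) h x - Q (Fin.last N) h x| := by
      intro b h
      calc _ ≤ ∑ x, (|recordProb (K' b) h - recordProb Q' h| * K b (Fin.last N) h x +
            recordProb Q' h * |K b (Fin.last N) h x - Q (Fin.last N) h x|) := by
            refine Finset.sum_le_sum fun x _ => ?_
            rw [recordProb_snoc, recordProb_snoc]
            calc _ = |(recordProb (K' b) h - recordProb Q' h) * K b (Fin.last N) h x +
                recordProb Q' h * (K b (Fin.last N) h x - Q (Fin.last N) h x)| := by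
                  congr 1; ring
              _ ≤ _ := abs_add_le _ _
              _ = _ := by
                rw [abs_mul, abs_mul, abs_of_nonneg (hQ'0 h), abs_of_nonneg (hK _ _ _ _)]
        _ = _ := by
            rw [Finset.sum_add_distrib, ← Finset.mul_sum, ← Finset.mul_sum, hK1 b (Fin.last N) h,
              mul_one]
    calc _ ≤ ∑ b, ∑ h, (|recordProb (K' b) h - recordProb Q' h| +
          recordProb Q' h * ∑ x, |K b (Fin.last N) h x - Q (Fin.last N) h x|) := by
          refine Finset.sum_le_sum fun b _ => ?_
          rw [sum_fin_succ_pi]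
          exact Finset.sum_le_sum fun h _ => hstep b h
      -- The weight of the last-round term is the reference probability, which does not depend on b.
      -- The sum over b can therefore be taken at a fixed history, the only form in which `hΔ`
      -- applies.
      _ = ∑ b, ∑ h, |recordProb (K' b) h - recordProb Q' h| +
          ∑ h, recordProb Q' h * ∑ b, ∑ x, |K b (Fin.last N) h x - Q (Fin.last N) h x| := by
          simp_rw [Finset.sum_add_distrib, Finset.mul_sum]
          congr 1
          exact Finset.sum_comm
      _ ≤ N * Δ + ∑ h, recordProb Q' h * Δ :=
          add_le_add hIH (Finset.sum_le_sum fun h _ =>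
            mul_le_mul_of_nonneg_left (hΔ (Fin.last N) h) (hQ'0 h))
      _ = _ := by rw [← Finset.sum_mul, hQ'1]; push_cast; ring

end Adaptive

/-! ### Lower bounds -/

/-- Estimating all hard channels well forces the outcome distributions away from any reference. -/
lemma EstimatesWithProb.mul_le_one_add {n : ℕ} {R : Type*} [Fintype R]
    {prob : PauliChannel n → R → ℝ} {est : R → PauliLabel n → ℝ} {p : ℝ}
    (h : EstimatesWithProb prob est p) {Q : R → ℝ} (hQ : ∀ r, 0 ≤ Q r) (hQ1 : ∑ r, Q r = 1) :
    (4 ^ n - 1) * p ≤ 1 + ∑ b : {b : PauliLabel n // b ≠ 0},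
      ∑ r, |prob (markedChannel b) r - Q r| := by
  classical
  calc (4 ^ n - 1) * p = ∑ b : {b : PauliLabel n // b ≠ 0}, p := by
        rw [Finset.sum_const, Finset.card_univ, nsmul_eq_mul, card_ne_zero_label]
    _ ≤ ∑ b : {b : PauliLabel n // b ≠ 0},
        (∑ r with GoodEstimate (markedChannel b) (est r), Q r +
          ∑ r, |prob (markedChannel b) r - Q r|) := by
        refine Finset.sum_le_sum fun b _ => ?_
        have hb : p ≤ ∑ r with GoodEstimate (markedChannel b) (est r),
            prob (markedChannel b) r := by
          convert h (markedChannel b)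
        have h2 : ∑ r with GoodEstimate (markedChannel b) (est r),
            |prob (markedChannel b) r - Q r| ≤ ∑ r, |prob (markedChannel b) r - Q r| :=
          Finset.sum_le_sum_of_subset_of_nonneg (Finset.subset_univ _) fun r _ _ => abs_nonneg _
        refine hb.trans (le_trans ?_ (add_le_add_right h2 _))
        rw [← Finset.sum_add_distrib]
        exact Finset.sum_le_sum fun r _ => by linarith [le_abs_self (prob (markedChannel b) r - Q r)]
    _ ≤ _ := by
        rw [Finset.sum_add_distrib]
        refine add_le_add_left ?_ _
        convert sum_sum_goodEstimate_le est hQ hQ1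

lemma four_pow_eq_sq (n : ℕ) : (4 : ℝ) ^ n = (2 ^ n) ^ 2 := by
  rw [← pow_mul, mul_comm, pow_mul]; norm_num

/-- The hypothesis says 2^(n-k) ≤ (24 N)², which already gives the exponent (n-k)/2; the exponent
(n-k)/3 follows because the power y is at least 1, so y² ≤ y³. -/
lemma rpow_div_three_le_of_two_pow_le {n k N : ℕ} (hkn : k ≤ n)
    (h : (2 : ℝ) ^ n ≤ 576 * N ^ 2 * 2 ^ k) :
    1 / 24 * (2 : ℝ) ^ (((n : ℝ) - (k : ℝ)) / 3) ≤ N := by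
  set y := (2 : ℝ) ^ (((n : ℝ) - (k : ℝ)) / 3) with hy
  have hk : (k : ℝ) ≤ n := by exact_mod_cast hkn
  have hy1 : 1 ≤ y := Real.one_le_rpow (by norm_num) (by linarith)
  have hy3 : y ^ 3 = 2 ^ n / 2 ^ k := by
    rw [hy, ← Real.rpow_natCast, ← Real.rpow_mul (by norm_num)]
    push_cast
    rw [div_mul_cancel₀ _ (by norm_num), Real.rpow_sub (by norm_num), Real.rpow_natCast,
      Real.rpow_natCast]
  have h3 : y ^ 3 ≤ (24 * (N : ℝ)) ^ 2 := by
    rw [hy3, div_le_iff₀ (by positivity)]; linarith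
  have h4 : y ^ 2 ≤ (24 * (N : ℝ)) ^ 2 := (pow_le_pow_right₀ hy1 (by norm_num)).trans h3
  have := le_of_sq_le_sq h4 (by positivity)
  linarith

/-- The conclusion of the hybrid argument, given the distinguishability of one round. -/
lemma rpow_div_three_le_of_hybrid {n k N : ℕ} (hn : 1 ≤ n) (hkn : k ≤ n) {p δ Δ : ℝ}
    (hp : 1 / 2 < p) (h : (4 ^ n - 1) * p ≤ 1 + δ) (hδ : δ ≤ N * Δ)
    (hΔ : Δ ^ 2 ≤ 9 * (4 ^ n * (2 ^ n * 2 ^ k))) :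
    1 / 24 * (2 : ℝ) ^ (((n : ℝ) - (k : ℝ)) / 3) ≤ N := by
  refine rpow_div_three_le_of_two_pow_le hkn ?_
  have h4 : (4 : ℝ) ≤ 4 ^ n := le_self_pow₀ (by norm_num) (by omega)
  -- From (4^n − 1)/2 − 1 ≥ 4^n/8, with equality at n = 1. Squaring this against `hΔ` gives the
  -- constant 576 = 64·9.
  have h1 : (4 : ℝ) ^ n / 8 ≤ N * Δ := by nlinarith
  have h2 : ((4 : ℝ) ^ n / 8) ^ 2 ≤ N ^ 2 * (9 * (4 ^ n * (2 ^ n * 2 ^ k))) := by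
    calc _ ≤ (N * Δ) ^ 2 := pow_le_pow_left₀ (by positivity) h1 2
      _ = N ^ 2 * Δ ^ 2 := mul_pow _ _ _
      _ ≤ _ := mul_le_mul_of_nonneg_left hΔ (by positivity)
  have hx : (0 : ℝ) < 2 ^ n := by positivity
  have hG := four_pow_eq_sq n
  rw [hG] at h2
  have h5 : (2 ^ n) ^ 3 * (2 : ℝ) ^ n ≤ (2 ^ n) ^ 3 * (576 * N ^ 2 * 2 ^ k) := by nlinarith
  exact le_of_mul_le_mul_left h5 (by positivity)

theorem AdaptiveProtocol.le_of_estimatesWithProb {n k N : ℕ} {O : Type} [Fintype O]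
    (A : AdaptiveProtocol n k N O) (hn : 1 ≤ n) (hkn : k ≤ n) {p : ℝ} (hp : 1 / 2 < p)
    (h : EstimatesWithProb A.prob A.estimate p) :
    1 / 24 * (2 : ℝ) ^ (((n : ℝ) - (k : ℝ)) / 3) ≤ N := by
  set K : PauliChannel n → (i : Fin N) → (Fin i → O) → O → ℝ :=
    fun L i g => (A.meas i g).prob (L.applyAux (A.input i g).mat)
  have hK0 : ∀ L i g x, 0 ≤ K L i g x := fun L i g => (A.meas i g).prob_applyAux_nonneg _ L
  have hK1 : ∀ L i g, ∑ x, K L i g x = 1 := fun L i g => (A.meas i g).sum_prob_applyAux _ L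
  refine rpow_div_three_le_of_hybrid hn hkn hp
    (h.mul_le_one_add (Q := recordProb (K (backgroundChannel n)))
      (recordProb_nonneg (hK0 _)) (sum_recordProb (hK1 _)))
    (sum_abs_recordProb_sub_le (K := fun b => K (markedChannel b)) (fun b => hK0 _)
      (fun b => hK1 _) (hK0 _) (hK1 _)
      fun i g => (A.meas i g).sum_abs_prob_applyAux_sub_le (A.input i g)) ?_
  rw [Real.sq_sqrt (by positivity)]
  have : (Fintype.card (Qubits k) : ℝ) = 2 ^ k := by simp
  rw [this]
  have : (0 : ℝ) ≤ 4 ^ n * (2 ^ n * 2 ^ k) := by positivity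
  linarith

/-- Everything before the last use of the channel is absorbed into the state it acts on, so the
number of uses in a round drops out. -/
lemma PauliChannel.exists_concat_eq_apply {n : ℕ} (L : PauliChannel n)
    (procs : List (QChannel (Qubits n))) {ρ : Matrix (Qubits n) (Qubits n) ℂ}
    (hρ : ρ.PosSemidef) (ht : ρ.trace = 1) :
    ∃ σ : Matrix (Qubits n) (Qubits n) ℂ, σ.PosSemidef ∧ σ.trace = 1 ∧
      L.concat procs ρ = L.apply σ := by
  induction procs generalizing ρ with
  | nil => exact ⟨ρ, hρ, ht, rfl⟩
  | cons C procs ih =>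
    exact ih (C.posSemidef_map (L.posSemidef_apply hρ))
      (by rw [C.tracePreserving, L.trace_apply, ht])

theorem ConcatProtocol.le_of_estimatesWithProb {n N : ℕ} {O : Type} [Fintype O]
    (A : ConcatProtocol n N O) (hn : 1 ≤ n) {p : ℝ} (hp : 1 / 2 < p)
    (h : EstimatesWithProb A.prob A.estimate p) :
    1 / 24 * (2 : ℝ) ^ ((n : ℝ) / 3) ≤ N := by
  choose σ hσ hσt hconcat using fun (L : PauliChannel n) (i : Fin N) (g : Fin i → O) =>
    L.exists_concat_eq_apply (A.proc i g) (A.input i g).posSemidef (A.input i g).trace_eq_one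
  set K : PauliChannel n → (i : Fin N) → (Fin i → O) → O → ℝ :=
    fun L i g => (A.meas i g).prob (L.concat (A.proc i g) (A.input i g).mat)
  -- The reference is measuring the maximally mixed state, which depends neither on b nor on the
  -- processing channels.
  set Q : (i : Fin N) → (Fin i → O) → O → ℝ :=
    fun i g x => ((A.meas i g).effect x).trace.re / 2 ^ n
  have hK0 : ∀ L i g x, 0 ≤ K L i g x := fun L i g x => (A.meas i g).prob_nonneg
    (by rw [hconcat]; exact L.posSemidef_apply (hσ L i g)) x
  have hK1 : ∀ L i g, ∑ x, K L i g x = 1 := fun L i g => (A.meas i g).sum_prob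
    (by rw [hconcat, L.trace_apply, hσt])
  have hQ0 : ∀ i g x, 0 ≤ Q i g x := fun i g x =>
    div_nonneg ((A.meas i g).posSemidef x).re_trace_nonneg (by positivity)
  have hQ1 : ∀ i g, ∑ x, Q i g x = 1 := fun i g => by
    rw [← Finset.sum_div, (A.meas i g).sum_trace]; simp
  have key := rpow_div_three_le_of_hybrid (k := 0) (Δ := 3 * (2 ^ n * √(2 ^ n))) hn (Nat.zero_le n) hp
    (h.mul_le_one_add (Q := recordProb Q) (recordProb_nonneg hQ0) (sum_recordProb hQ1))
    (sum_abs_recordProb_sub_le (K := fun b => K (markedChannel b)) (fun b => hK0 _)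
      (fun b => hK1 _) hQ0 hQ1 fun i g => by
        simp only [K, Q, hconcat]
        exact (A.meas i g).sum_abs_prob_markedChannel_apply_sub_le (fun b => hσ _ i g)
          fun b => hσt _ i g) (by
      rw [mul_pow, mul_pow, Real.sq_sqrt (by positivity), four_pow_eq_sq]
      apply le_of_eq; ring)
  simpa using key

lemma ConcatProtocol.rounds_le_samples {n N : ℕ} {O : Type} [Fintype O]
    (A : ConcatProtocol n N O) (o : Fin N → O) : N ≤ A.samples o := by
  simp [ConcatProtocol.samples, Finset.sum_add_distrib]

/-! ### Fully entangled protocols -/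

section Entangled

variable {n : ℕ} {κ : Type*} [Fintype κ] [DecidableEq κ]

/-- Domination of the error rates makes the difference a nonnegative mixture of Pauli conjugations.
-/
lemma posSemidef_four_smul_applyAux_sub (b : {b : PauliLabel n // b ≠ 0})
    {ρ : Matrix (Qubits n × κ) (Qubits n × κ) ℂ} (hρ : ρ.PosSemidef) :
    ((4 : ℂ) • (backgroundChannel n).applyAux ρ - (markedChannel b).applyAux ρ).PosSemidef := by
  have h : (4 : ℂ) • (backgroundChannel n).applyAux ρ - (markedChannel b).applyAux ρ =
      ∑ a, ((4 * (backgroundChannel n).rate a - (markedChannel b).rate a : ℝ) : ℂ) •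
        ((pauli a ⊗ₖ (1 : Matrix κ κ ℂ)) * ρ * (pauli a ⊗ₖ (1 : Matrix κ κ ℂ))) := by
    simp only [PauliChannel.applyAux, Finset.smul_sum]
    rw [← Finset.sum_sub_distrib]
    refine Finset.sum_congr rfl fun a _ => ?_
    push_cast
    module
  rw [h]
  exact posSemidef_sum_smul_conj (fun a => sub_nonneg.mpr (markedChannel_rate_le b a))
    pauli_kronecker_one_isHermitian hρ

lemma PauliChannel.applyAux_smul_sub (L : PauliChannel n) (c : ℂ)
    (ρ σ : Matrix (Qubits n × κ) (Qubits n × κ) ℂ) :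
    L.applyAux (c • ρ - σ) = c • L.applyAux ρ - L.applyAux σ := by
  simp only [PauliChannel.applyAux, Finset.smul_sum]
  rw [← Finset.sum_sub_distrib]
  refine Finset.sum_congr rfl fun a _ => ?_
  rw [Matrix.mul_sub, Matrix.sub_mul, Matrix.mul_smul, Matrix.smul_mul, smul_sub, smul_comm]

lemma PauliChannel.foldl_posSemidef_and_trace (L : PauliChannel n)
    (procs : List (QChannel (Qubits n × κ))) {ρ : Matrix (Qubits n × κ) (Qubits n × κ) ℂ}
    (hρ : ρ.PosSemidef) :
    (procs.foldl (fun σ C => C.map (L.applyAux σ)) ρ).PosSemidef ∧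
      (procs.foldl (fun σ C => C.map (L.applyAux σ)) ρ).trace = ρ.trace := by
  induction procs generalizing ρ with
  | nil => exact ⟨hρ, rfl⟩
  | cons C procs ih =>
    have h := ih (C.posSemidef_map (L.posSemidef_applyAux hρ))
    rwa [C.tracePreserving, L.trace_applyAux] at h

lemma posSemidef_four_pow_smul_foldl_sub (b : {b : PauliLabel n // b ≠ 0})
    (procs : List (QChannel (Qubits n × κ))) (c : ℂ)
    {ρ σ : Matrix (Qubits n × κ) (Qubits n × κ) ℂ} (hσ : σ.PosSemidef)
    (h : (c • ρ - σ).PosSemidef) :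
    ((c * 4 ^ procs.length) •
        procs.foldl (fun σ C => C.map ((backgroundChannel n).applyAux σ)) ρ -
      procs.foldl (fun σ C => C.map ((markedChannel b).applyAux σ)) σ).PosSemidef := by
  induction procs generalizing c ρ σ with
  | nil => simpa using h
  | cons C procs ih =>
    have h1 := ih (c * 4) (ρ := C.map ((backgroundChannel n).applyAux ρ))
      (σ := C.map ((markedChannel b).applyAux σ))
      (C.posSemidef_map ((markedChannel b).posSemidef_applyAux hσ)) (by
        -- With Λ₀ the background, 4cΛ₀ρ − Λ_bσ = 4Λ₀(cρ − σ) + (4Λ₀σ − Λ_bσ): the first term is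
        -- positive by the invariant, the second by domination of one use.
        have h2 := (((backgroundChannel n).posSemidef_applyAux h).smul
          (show (0 : ℂ) ≤ 4 by norm_num)).add (posSemidef_four_smul_applyAux_sub b hσ)
        have h3 := C.posSemidef_map h2
        rw [PauliChannel.applyAux_smul_sub] at h3
        have e : C.map ((4 : ℂ) • (c • (backgroundChannel n).applyAux ρ -
              (backgroundChannel n).applyAux σ) +
            ((4 : ℂ) • (backgroundChannel n).applyAux σ - (markedChannel b).applyAux σ)) =
            (c * 4) • C.map ((backgroundChannel n).applyAux ρ) -
              C.map ((markedChannel b).applyAux σ) := by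
          rw [← map_smul, ← map_sub]
          congr 1
          module
        rwa [e] at h3)
    rw [List.length_cons, pow_succ', ← mul_assoc]
    exact h1

end Entangled

theorem EntangledProtocol.le_of_estimatesWithProb {n N : ℕ} {κ : Type} [Fintype κ]
    [DecidableEq κ] {O : Type} [Fintype O] (A : EntangledProtocol n N κ O) (hn : 1 ≤ n) {p : ℝ}
    (hp : 1 / 2 < p) (h : EstimatesWithProb A.prob A.estimate p) : n ≤ N := by
  classical
  have hstate := fun L : PauliChannel n =>
    L.foldl_posSemidef_and_trace (List.ofFn A.proc) A.input.posSemidef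
  have hQ0 : ∀ o, 0 ≤ A.prob (backgroundChannel n) o := A.meas.prob_nonneg (hstate _).1
  have hQ1 : ∑ o, A.prob (backgroundChannel n) o = 1 :=
    A.meas.sum_prob ((hstate _).2.trans A.input.trace_eq_one)
  have hle : ∀ b o, A.prob (markedChannel b) o ≤ 4 ^ N * A.prob (backgroundChannel n) o := by
    intro b o
    have h1 := posSemidef_four_pow_smul_foldl_sub b (List.ofFn A.proc) 1
      (ρ := A.input.mat) A.input.posSemidef (by simpa using Matrix.PosSemidef.zero)
    have h2 := A.meas.prob_nonneg h1 o
    rw [List.length_ofFn, one_mul, show (4 : ℂ) ^ N = ((4 ^ N : ℝ) : ℂ) by push_cast; rfl] at h2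
    simp only [POVM.prob, Matrix.mul_sub, Matrix.mul_smul, Matrix.trace_sub, Matrix.trace_smul,
      smul_eq_mul, Complex.sub_re, Complex.re_ofReal_mul] at h2
    exact sub_nonneg.mp h2
  have hsum : ((4 : ℝ) ^ n - 1) * p ≤ 4 ^ N := by
    calc ((4 : ℝ) ^ n - 1) * p = ∑ b : {b : PauliLabel n // b ≠ 0}, p := by
          rw [Finset.sum_const, Finset.card_univ, nsmul_eq_mul, card_ne_zero_label]
      _ ≤ ∑ b : {b : PauliLabel n // b ≠ 0}, 4 ^ N *
          ∑ o with GoodEstimate (markedChannel b) (A.estimate o),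
            A.prob (backgroundChannel n) o := by
          refine Finset.sum_le_sum fun b _ => ?_
          have hb : p ≤ ∑ o with GoodEstimate (markedChannel b) (A.estimate o),
              A.prob (markedChannel b) o := by
            convert h (markedChannel b)
          rw [Finset.mul_sum]
          exact hb.trans (Finset.sum_le_sum fun o _ => hle b o)
      _ ≤ 4 ^ N * 1 := by
          rw [← Finset.mul_sum]
          refine mul_le_mul_of_nonneg_left ?_ (by positivity)
          convert sum_sum_goodEstimate_le A.estimate hQ0 hQ1
      _ = 4 ^ N := mul_one _
  -- If N < n then 4^N ≤ 4^n/4, which is below (4^n − 1)/2 for n ≥ 1.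
  by_contra hlt
  have h4 : (4 : ℝ) ≤ 4 ^ n := le_self_pow₀ (by norm_num) (by omega)
  have hpow : (4 : ℝ) ^ N * 4 ≤ 4 ^ n := by
    rw [← pow_succ]; exact pow_le_pow_right₀ (by norm_num) (by omega)
  nlinarith

/-! ### Non-adaptive protocols -/

/-- The left side is at most 1 + χ², and 1 + x ≤ exp x; in this form the bound multiplies over
independent rounds. -/
lemma sum_sq_div_le_exp {O : Type*} [Fintype O] {P Q : O → ℝ}
    (hP1 : ∑ x, P x = 1) (hQ1 : ∑ x, Q x = 1) (hPQ : ∀ x, Q x = 0 → P x - Q x = 0) :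
    ∑ x, P x ^ 2 / Q x ≤ Real.exp (∑ x, (P x - Q x) ^ 2 / Q x) := by
  have h : ∀ x, P x ^ 2 / Q x = (P x - Q x) ^ 2 / Q x + (2 * P x - Q x) := by
    intro x
    by_cases hx : Q x = 0
    · have := hPQ x hx
      rw [hx, sub_zero] at this
      simp [hx, this]
    · field_simp; ring
  simp_rw [h]
  rw [Finset.sum_add_distrib, Finset.sum_sub_distrib, ← Finset.mul_sum, hP1, hQ1]
  linarith [Real.add_one_le_exp (∑ x, (P x - Q x) ^ 2 / Q x)]

/-- A `χ²` change of measure for product distributions. -/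
lemma sq_sum_prod_le {O : Type*} [Fintype O] {N : ℕ} {P Q : Fin N → O → ℝ}
    (hQ : ∀ i x, 0 ≤ Q i x) (hP1 : ∀ i, ∑ x, P i x = 1) (hQ1 : ∀ i, ∑ x, Q i x = 1)
    (hPQ : ∀ i x, Q i x = 0 → P i x - Q i x = 0) (s : Finset (Fin N → O)) :
    (∑ o ∈ s, ∏ i, P i (o i)) ^ 2 ≤
      (∑ o ∈ s, ∏ i, Q i (o i)) * Real.exp (∑ i, ∑ x, (P i x - Q i x) ^ 2 / Q i x) := by
  have hnn : ∀ o : Fin N → O, 0 ≤ ∏ i, P i (o i) ^ 2 / Q i (o i) := fun o =>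
    Finset.prod_nonneg fun i _ => div_nonneg (sq_nonneg _) (hQ i _)
  have hQnn : ∀ o : Fin N → O, 0 ≤ ∏ i, Q i (o i) := fun o =>
    Finset.prod_nonneg fun i _ => hQ i _
  -- Cauchy–Schwarz for the factorization P² = Q · (P²/Q); the second factor is then summed over all
  -- records and splits into rounds.
  refine (Finset.sum_sq_le_sum_mul_sum_of_sq_le_mul s (f := fun o => ∏ i, Q i (o i))
    (g := fun o => ∏ i, P i (o i) ^ 2 / Q i (o i)) (fun o _ => hQnn o) (fun o _ => hnn o)
    fun o _ => ?_).trans (mul_le_mul_of_nonneg_left ?_ (Finset.sum_nonneg fun o _ => hQnn o))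
  · rw [← Finset.prod_pow, ← Finset.prod_mul_distrib]
    refine le_of_eq (Finset.prod_congr rfl fun i _ => ?_)
    by_cases hx : Q i (o i) = 0
    · have := hPQ i _ hx
      rw [hx, sub_zero] at this
      simp [hx, this]
    · rw [mul_div_cancel₀ _ hx]
  · calc _ ≤ ∑ o : Fin N → O, ∏ i, P i (o i) ^ 2 / Q i (o i) :=
          Finset.sum_le_sum_of_subset_of_nonneg (Finset.subset_univ _) fun o _ _ => hnn o
      _ = ∏ i, ∑ x, P i x ^ 2 / Q i x :=
          (Fintype.prod_sum fun i x => P i x ^ 2 / Q i x).symm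
      _ ≤ ∏ i, Real.exp (∑ x, (P i x - Q i x) ^ 2 / Q i x) :=
          Finset.prod_le_prod (fun i _ => Finset.sum_nonneg fun x _ =>
            div_nonneg (sq_nonneg _) (hQ i x))
            fun i _ => sum_sq_div_le_exp (hP1 i) (hQ1 i) (hPQ i)
      _ = _ := (Real.exp_sum _ _).symm

/-- From p² > 1/4 and log x ≤ x − 1. The scaling by M makes the bound linear in q, so it can be
summed over b using only Σ q ≤ 1. -/
lemma log_div_four_le {M p q t : ℝ} (hM : 0 < M) (hp : 1 / 2 < p) (h : p ^ 2 ≤ q * Real.exp t) :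
    Real.log (M / 4) ≤ M * q - 1 + t := by
  have h4 : 1 / 4 ≤ q * Real.exp t := by nlinarith
  have hq : 0 < q := pos_of_mul_pos_left (by linarith) (Real.exp_pos t).le
  calc Real.log (M / 4) ≤ Real.log (M * q * Real.exp t) :=
        Real.log_le_log (by positivity) (by nlinarith)
    _ = Real.log (M * q) + t := by
        rw [Real.log_mul (by positivity) (Real.exp_pos _).ne', Real.log_exp]
    _ ≤ _ := by linarith [Real.log_le_sub_one_of_pos (mul_pos hM hq)]

/-- M is the number of hypotheses, so the M terms −1 cancel M Σ q ≤ M. -/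
lemma card_mul_le_of_forall_le {B : Type*} [Fintype B] {M l T : ℝ} {q t : B → ℝ}
    (hcard : (Fintype.card B : ℝ) = M) (hM : 0 ≤ M) (h : ∀ b, l ≤ M * q b - 1 + t b)
    (hq : ∑ b, q b ≤ 1) (ht : ∑ b, t b ≤ T) : M * l ≤ T := by
  have hsum := Finset.sum_le_sum fun b (_ : b ∈ Finset.univ) => h b
  rw [Finset.sum_add_distrib, Finset.sum_sub_distrib, ← Finset.mul_sum, Finset.sum_const,
    Finset.sum_const, Finset.card_univ, nsmul_eq_mul, nsmul_eq_mul, hcard] at hsum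
  linarith [mul_le_mul_of_nonneg_left hq hM]

/-- A Fano-type inequality for the hard channels. -/
lemma NonadaptiveProtocol.mul_log_le {n k N : ℕ} {O : Type} [Fintype O]
    (A : NonadaptiveProtocol n k N O) (hn : 1 ≤ n) {p : ℝ} (hp : 1 / 2 < p)
    (h : EstimatesWithProb A.prob A.estimate p) :
    ((4 : ℝ) ^ n - 1) * Real.log ((4 ^ n - 1) / 4) ≤ N * (8 * (2 ^ n * 2 ^ k)) := by
  classical
  set M : ℝ := (4 : ℝ) ^ n - 1 with hM
  have h4 : (4 : ℝ) ≤ 4 ^ n := le_self_pow₀ (by norm_num) (by omega)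
  have hM0 : 0 < M := by linarith
  set K : PauliChannel n → Fin N → O → ℝ :=
    fun L i => (A.meas i).prob (L.applyAux (A.input i).mat)
  set q : {b : PauliLabel n // b ≠ 0} → ℝ := fun b =>
    ∑ o with GoodEstimate (markedChannel b) (A.estimate o), A.prob (backgroundChannel n) o
  set t : {b : PauliLabel n // b ≠ 0} → ℝ := fun b =>
    ∑ i, ∑ x, (K (markedChannel b) i x - K (backgroundChannel n) i x) ^ 2 /
      K (backgroundChannel n) i x
  have hK0 : ∀ L i x, 0 ≤ K L i x := fun L i => (A.meas i).prob_applyAux_nonneg _ L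
  have hK1 : ∀ L i, ∑ x, K L i x = 1 := fun L i => (A.meas i).sum_prob_applyAux _ L
  have hQ0 : ∀ o, 0 ≤ A.prob (backgroundChannel n) o := fun o =>
    Finset.prod_nonneg fun i _ => hK0 _ i _
  have hQ1 : ∑ o, A.prob (backgroundChannel n) o = 1 := by
    simp only [NonadaptiveProtocol.prob]
    rw [← Fintype.prod_sum fun i x => K (backgroundChannel n) i x]
    simp [hK1]
  have hq1 : ∑ b, q b ≤ 1 := by
    convert sum_sum_goodEstimate_le A.estimate hQ0 hQ1
  have ht : ∑ b, t b ≤ N * (8 * (2 ^ n * 2 ^ k)) := by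
    rw [Finset.sum_comm]
    calc _ ≤ ∑ _i : Fin N, (8 * ((2 : ℝ) ^ n * 2 ^ k)) := Finset.sum_le_sum fun i _ => by
          have := (A.meas i).sum_chiSq_le (A.input i)
          rwa [show (Fintype.card (Qubits k) : ℝ) = 2 ^ k by simp] at this
      _ = _ := by simp
  have hb : ∀ b, Real.log (M / 4) ≤ M * q b - 1 + t b := by
    intro b
    have h1 : p ≤ ∑ o with GoodEstimate (markedChannel b) (A.estimate o),
        A.prob (markedChannel b) o := by
      convert h (markedChannel b)
    exact log_div_four_le hM0 hp ((pow_le_pow_left₀ (by linarith) h1 2).trans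
      (sq_sum_prod_le (hK0 _) (hK1 _) (hK1 _)
        (fun i x hx => (A.meas i).prob_applyAux_sub_eq_zero (A.input i) hx b) _))
  exact card_mul_le_of_forall_le (card_ne_zero_label n) hM0.le hb hq1 ht

theorem NonadaptiveProtocol.le_of_estimatesWithProb {n k N : ℕ} {O : Type} [Fintype O]
    (A : NonadaptiveProtocol n k N O) (hn : 1 ≤ n) (hkn : k ≤ n) {p : ℝ} (hp : 1 / 2 < p)
    (h : EstimatesWithProb A.prob A.estimate p) :
    1 / 64 * ((n : ℝ) * 2 ^ (n - k)) ≤ N := by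
  -- For n = 1 the logarithm is log(3/4) < 0 and says nothing. There N ≥ 1 suffices, obtained by
  -- viewing the protocol as an adaptive one.
  obtain rfl | hn2 : n = 1 ∨ 2 ≤ n := by omega
  · have hN : (0 : ℝ) < N := by
      have := AdaptiveProtocol.le_of_estimatesWithProb
        (A := ⟨fun i _ => A.input i, fun i _ => A.meas i, A.estimate⟩) hn hkn hp h
      exact lt_of_lt_of_le (by positivity) this
    have hN1 : (1 : ℝ) ≤ N := by exact_mod_cast hN
    have : (2 : ℝ) ^ (1 - k) ≤ 2 ^ 1 := pow_le_pow_right₀ (by norm_num) (by omega)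
    push_cast
    linarith
  · have hlog := A.mul_log_le hn hp h
    have h2n : (4 : ℝ) ≤ 2 ^ n := by
      calc (4 : ℝ) = 2 ^ 2 := by norm_num
        _ ≤ 2 ^ n := pow_le_pow_right₀ (by norm_num) hn2
    have h4n := four_pow_eq_sq n
    have hlow : (n : ℝ) / 4 ≤ Real.log ((4 ^ n - 1) / 4) := by
      have h1 : ((n : ℝ) - 1) * Real.log 2 ≤ Real.log ((4 ^ n - 1) / 4) := by
        rw [show ((n : ℝ) - 1) * Real.log 2 = Real.log (2 ^ n / 2) by
          rw [Real.log_div (by positivity) (by norm_num), Real.log_pow]; ring]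
        refine Real.log_le_log (by positivity) ?_
        rw [h4n]; nlinarith
      have h2 : (2 : ℝ) ≤ n := by exact_mod_cast hn2
      nlinarith [Real.log_two_gt_d9]
    have hsplit : (2 : ℝ) ^ n = 2 ^ (n - k) * 2 ^ k := by rw [← pow_add, Nat.sub_add_cancel hkn]
    have h3 : (4 : ℝ) ^ n / 2 * ((n : ℝ) / 4) ≤ N * (8 * (2 ^ n * 2 ^ k)) := by
      refine le_trans (mul_le_mul (by nlinarith) hlow (by positivity) (by nlinarith)) hlog
    -- The constant is 64 = 2·4·8: from 4^n − 1 ≥ 4^n/2, the bound n/4 on the logarithm, and the χ²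
    -- constant.
    have h5 : (2 ^ n * 2 ^ k) * (1 / 64 * ((n : ℝ) * 2 ^ (n - k))) ≤ (2 ^ n * 2 ^ k) * N := by
      have e : (4 : ℝ) ^ n = 2 ^ n * (2 ^ (n - k) * 2 ^ k) := by rw [← hsplit, h4n, sq]
      rw [e] at h3
      linarith
    exact le_of_mul_le_mul_left h5 (by positivity)

end

theorem theorem2 (p : ℝ) (hp : 1 / 2 < p) :
    (∃ c : ℝ, 0 < c ∧ ∀ (n k N : ℕ) (O : Type) [Fintype O] (A : NonadaptiveProtocol n k N O),
      1 ≤ n → k ≤ n → EstimatesWithProb A.prob A.estimate p →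
        c * ((n : ℝ) * 2 ^ (n - k)) ≤ (N : ℝ)) ∧
    (∃ c : ℝ, 0 < c ∧ ∀ (n k N : ℕ) (O : Type) [Fintype O] (A : AdaptiveProtocol n k N O),
      1 ≤ n → k ≤ n → EstimatesWithProb A.prob A.estimate p →
        c * (2 : ℝ) ^ (((n : ℝ) - (k : ℝ)) / 3) ≤ (N : ℝ)) ∧
    (∃ c : ℝ, 0 < c ∧ ∀ (n N' : ℕ) (O : Type) [Fintype O] (A : ConcatProtocol n N' O),
      1 ≤ n → EstimatesWithProb A.prob A.estimate p →
        c * (2 : ℝ) ^ ((n : ℝ) / 3) ≤ (N' : ℝ) ∧ ∀ o : Fin N' → O, N' ≤ A.samples o) ∧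
    (∃ c : ℝ, 0 < c ∧ ∀ (n N : ℕ) (κ : Type) [Fintype κ] [DecidableEq κ]
      (O : Type) [Fintype O] (A : EntangledProtocol n N κ O),
      1 ≤ n → EstimatesWithProb A.prob A.estimate p →
        c * (n : ℝ) ≤ (N : ℝ)) := by
  refine ⟨⟨1 / 64, by norm_num, fun n k N O _ A hn hkn h =>
      A.le_of_estimatesWithProb hn hkn hp h⟩,
    ⟨1 / 24, by norm_num, fun n k N O _ A hn hkn h => A.le_of_estimatesWithProb hn hkn hp h⟩,
    ⟨1 / 24, by norm_num, fun n N O _ A hn h =>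
      ⟨A.le_of_estimatesWithProb hn hp h, A.rounds_le_samples⟩⟩,
    ⟨1, one_pos, fun n N κ _ _ O _ A hn h => ?_⟩⟩
  rw [one_mul]
  exact_mod_cast A.le_of_estimatesWithProb hn hp h
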